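/- An Orlicz function is a convex, symmetric function $V:\mathbb R\to[0,\infty)$ with $V(0)=0$ and $V(x)>0$ for $x\ne0$. Let $\mathscr M_1(\mathbb R)$ be the set of Borel probability measures on $\mathbb R$ with the weak topology. For an Orlicz function $V$ and $\mu\in\mathscr M_1(\mathbb R)$ put $m_V(\mu)=\int V\,d\mu\in[0,\infty]$ and $\mathscr M_1^V(\mathbb R)=\{\mu\in\mathscr M_1(\mathbb R): m_V(\mu)<\infty\}$, with the metric $d_V(\mu,\nu)=d_w(\mu,\nu)+|m_V(\mu)-m_V(\nu)|$, where $d_w$ is any metric on $\mathscr M_1(\mathbb R)$ inducing the weak topology. For $\beta<0$ let $\mu_{V,\beta}$ be the probability measure with Lebesgue density $e^{\beta V(x)}/\int_{\mathbb R}e^{\beta V(t)}\,dt$, and let $H(\mu|\nu)=\int\log\frac{d\mu}{d\nu}\,d\mu$ if $\mu\ll\nu$, and $H(\mu|\nu)=\infty$ otherwise, be the relative entropy. A sequence $(\xi_n)_{n\ge1}$ of random variables in a topological space $\mathcal X$ satisfies an LDP in $\mathcal X$ with good rate function $I:\mathcal X\to[0,\infty]$ if all level sets $\{I\le c\}$,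 $c\in[0,\infty)$, are compact and, for every Borel set $A\subseteq\mathcal X$ with interior $A^\circ$ and closure $\overline A$, $$-\inf_{A^\circ} I\le\liminf_{n\to\infty}\tfrac1n\log\mathbb P[\xi_n\in A^\circ]\le\limsup_{n\to\infty}\tfrac1n\log\mathbb P[\xi_n\in\overline A]\le-\inf_{\overline A} I .$$ Theorem. Let $V$ be an Orlicz function, $R\in(0,\infty)$, and for every $n\ge1$ let $X^n=(X^n(1),\dots,X^n(n))$ be uniformly distributed on the Orlicz ball $\mathbb B^{n,V}_R=\{x\in\mathbb R^n:\sum_{k=1}^nV(x_k)\le Rn\}$. Put $\mathcal L^{n}=\frac1n\sum_{i=1}^n\delta_{X^n(i)}$. Then there is a unique $\overline\alpha\in(-\infty,0)$ such that $(\mathcal L^{n})_{n\ge1}$ satisfies an LDP in $\mathscr M_1(\mathbb R)$ with good rate function $\mathbb I_V:\mathscr M_1(\mathbb R)\to[0,\infty]$, $$\mathbb I_V(\mu)=\begin{cases}H(\mu|\mu_{V,\overline\alpha})+\overline\alpha\,[m_V(\mu)-R], & m_V(\mu)\le R,\\ \infty, & \text{otherwise},\end{cases}$$ and $\mathbb I_V$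 is strictly convex on the set where it is finite. If moreover $W$ is an Orlicz function with $V(x)/W(x)\to\infty$ as $|x|\to\infty$, then $(\mathcal L^{n})_{n\ge1}$ also satisfies an LDP in $(\mathscr M_1^W(\mathbb R),d_W)$, with good rate function the restriction of $\mathbb I_V$ to $\mathscr M_1^W(\mathbb R)$. -/

import Mathlib

open MeasureTheory ProbabilityTheory Filter Topology
open scoped ENNReal NNReal

noncomputable section

namespace OrliczLDP

/-- An Orlicz function: convex, symmetric, zero at the origin and positive elsewhere. -/
structure IsOrlicz (V : ℝ → ℝ) : Prop where
  convex : ConvexOn ℝ Set.univ V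
  even : ∀ x, V (-x) = V x
  zero : V 0 = 0
  pos : ∀ x, x ≠ 0 → 0 < V x

/-- The Orlicz ball of radius `R` in `ℝⁿ`: all `x` with `V (x₁) + ⋯ + V (xₙ) ≤ R n`. -/
def orliczBall (V : ℝ → ℝ) (R : ℝ) (n : ℕ) : Set (Fin n → ℝ) :=
  {x | ∑ k, V (x k) ≤ R * n}

/-- The Gibbs measure with Lebesgue density `exp (β V x) / ∫ exp (β V t) dt`. -/
def gibbs (V : ℝ → ℝ) (β : ℝ) : Measure ℝ :=
  (volume : Measure ℝ).withDensity
    fun x => ENNReal.ofReal (Real.exp (β * V x) / ∫ t, Real.exp (β * V t))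

/-- The moment `∫ V dμ`, with values in `[0, ∞]` (for `V ≥ 0`). -/
def moment (V : ℝ → ℝ) (μ : ProbabilityMeasure ℝ) : ℝ≥0∞ :=
  ∫⁻ x, ENNReal.ofReal (V x) ∂(μ : Measure ℝ)

/-- The set of probability measures on `ℝ` with finite `W`-moment. -/
def FiniteMoment (W : ℝ → ℝ) : Type :=
  {μ : ProbabilityMeasure ℝ // moment W μ < ∞}

/-- The weak topology on the probability measures on `ℝ`. -/
@[reducible]
def weakTopology : TopologicalSpace (ProbabilityMeasure ℝ) :=
  ProbabilityMeasure.instTopologicalSpace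

/-- The metric `d_w` induces the weak topology. -/
def InducesWeakTopology (dw : MetricSpace (ProbabilityMeasure ℝ)) : Prop :=
  dw.toPseudoMetricSpace.toUniformSpace.toTopologicalSpace = weakTopology

/-- The metric `d_W (μ, ν) = d_w (μ, ν) + |m_W (μ) - m_W (ν)|` on the probability measures with
finite `W`-moment, built from a metric `d_w` on the probability measures on `ℝ`. -/
@[reducible]
def wassersteinMetric (dw : MetricSpace (ProbabilityMeasure ℝ)) (W : ℝ → ℝ) :
    MetricSpace (FiniteMoment W) where
  dist μ ν := dw.dist μ.1 ν.1 + |(moment W μ.1).toReal - (moment W ν.1).toReal|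
  dist_self μ := by
    have h : dw.dist μ.1 μ.1 = 0 := dw.dist_self μ.1
    rw [h, sub_self, abs_zero, add_zero]
  dist_comm μ ν := by
    have h : dw.dist μ.1 ν.1 = dw.dist ν.1 μ.1 := dw.dist_comm μ.1 ν.1
    rw [h, abs_sub_comm]
  dist_triangle μ ν ρ := by
    have h : dw.dist μ.1 ρ.1 ≤ dw.dist μ.1 ν.1 + dw.dist ν.1 ρ.1 :=
      dw.dist_triangle μ.1 ν.1 ρ.1
    have h' := abs_sub_le (moment W μ.1).toReal (moment W ν.1).toReal (moment W ρ.1).toReal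
    linarith
  eq_of_dist_eq_zero := by
    intro μ ν h
    have h0 : 0 ≤ dw.dist μ.1 ν.1 := @dist_nonneg _ dw.toPseudoMetricSpace μ.1 ν.1
    have h1 := abs_nonneg ((moment W μ.1).toReal - (moment W ν.1).toReal)
    have h2 : dw.dist μ.1 ν.1 = 0 := by linarith
    exact Subtype.ext (dw.eq_of_dist_eq_zero h2)

/-- The empirical measure `(1/n) ∑ δ_{xᵢ}` of the coordinates of `x ∈ ℝⁿ`, `n ≥ 1`. -/
def empirical (n : ℕ+) (x : Fin n → ℝ) : ProbabilityMeasure ℝ :=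
  ⟨((n : ℕ) : ℝ≥0∞)⁻¹ • ∑ i, Measure.dirac (x i), ⟨by
    simp [ENNReal.inv_mul_cancel]⟩⟩

theorem moment_empirical_lt_top (W : ℝ → ℝ) (n : ℕ+) (x : Fin n → ℝ) :
    moment W (empirical n x) < ∞ := by
  simp only [moment, empirical, ProbabilityMeasure.coe_mk, lintegral_smul_measure,
    lintegral_finsetSum_measure, lintegral_dirac, smul_eq_mul]
  exact ENNReal.mul_lt_top (by simp) (ENNReal.sum_lt_top.2 fun i _ => ENNReal.ofReal_lt_top)

/-- The empirical measure as a point of the space of measures with finite `W`-moment. -/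
def empiricalFM (W : ℝ → ℝ) (n : ℕ+) (x : Fin n → ℝ) : FiniteMoment W :=
  ⟨empirical n x, moment_empirical_lt_top W n x⟩

/-- A good rate function: all level sets are compact. -/
def IsGoodRate {X : Type*} [TopologicalSpace X] (I : X → ℝ≥0∞) : Prop :=
  ∀ c : ℝ≥0, IsCompact {x | I x ≤ c}

/-- `(1/n) log p`, with values in `[-∞, 0]` for a probability `p`. -/
def logScale (n : ℕ+) (p : ℝ≥0∞) : EReal :=
  ((1 / (n : ℕ) : ℝ) : EReal) * ENNReal.log p

/-- `I` is a good rate function and `(ξ n)` satisfies the large deviation principle with speed `n`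
and rate function `I`. The variables may live on different probability spaces. -/
structure SatisfiesLDP {X : Type*} [TopologicalSpace X]
    {Ω : ℕ+ → Type*} [∀ n, MeasurableSpace (Ω n)] (P : ∀ n, Measure (Ω n))
    (ξ : ∀ n, Ω n → X) (I : X → ℝ≥0∞) : Prop where
  good : IsGoodRate I
  lower : ∀ A : Set X, MeasurableSet[borel X] A →
    -(⨅ x ∈ interior A, (I x : EReal)) ≤
      liminf (fun n => logScale n (P n {ω | ξ n ω ∈ interior A})) atTop
  middle : ∀ A : Set X, MeasurableSet[borel X] A →
    liminf (fun n => logScale n (P n {ω | ξ n ω ∈ interior A})) atTop ≤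
      limsup (fun n => logScale n (P n {ω | ξ n ω ∈ closure A})) atTop
  upper : ∀ A : Set X, MeasurableSet[borel X] A →
    limsup (fun n => logScale n (P n {ω | ξ n ω ∈ closure A})) atTop ≤
      -(⨅ x ∈ closure A, (I x : EReal))

/-- The function equal to `H(μ | μ_{V,α}) + α (m_V(μ) - R)` if `m_V(μ) ≤ R` and to `∞` otherwise.
For `α < 0` the second summand is nonnegative on the first branch, so nothing is truncated. -/
def rate (V : ℝ → ℝ) (R α : ℝ) (μ : ProbabilityMeasure ℝ) : ℝ≥0∞ :=
  open Classical in
  if moment V μ ≤ ENNReal.ofReal R then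
    InformationTheory.klDiv (μ : Measure ℝ) (gibbs V α)
      + ENNReal.ofReal (α * ((moment V μ).toReal - R))
  else ∞

/-- The mixture `a μ + b ν` of two probability measures, `a + b = 1`. -/
def mix (a b : ℝ≥0) (hab : a + b = 1) (μ ν : ProbabilityMeasure ℝ) : ProbabilityMeasure ℝ :=
  ⟨a • (μ : Measure ℝ) + b • (ν : Measure ℝ), ⟨by
    simp only [Measure.coe_add, Pi.add_apply, Measure.smul_apply, measure_univ,
      ENNReal.smul_def, smul_eq_mul, mul_one]
    exact_mod_cast hab⟩⟩

/-- Strict convexity, on the set where it is finite, of a `[0, ∞]`-valued function of a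
probability measure (the convexity inequality being trivial outside that set). -/
def StrictlyConvex (I : ProbabilityMeasure ℝ → ℝ≥0∞) : Prop :=
  ∀ μ ν : ProbabilityMeasure ℝ, μ ≠ ν → I μ < ∞ → I ν < ∞ →
    ∀ (a b : ℝ≥0) (hab : a + b = 1), 0 < a → 0 < b →
      I (mix a b hab μ ν) < a * I μ + b * I ν

end OrliczLDP

end

open OrliczLDP

/-! If `μ` has Lebesgue density `ρ`, then (when the terms are finite) `H(μ|μ_{V,α}) = ∫ ρ log ρ - α
m_V(μ) + log Z(α)`, with `Z` the `partition`. Adding `α (m_V(μ) - R)` cancels the moment of `μ`, so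
the rate is `log Z(α) - α R`, the exponential growth rate of the volume of the ball, minus the
differential entropy of `μ`. Here `α` is a minimizer of `β ↦ ∫ exp (β (V - R))` over `β < 0`, and
stationarity says that the Gibbs measure has `V`-moment `R`.

All empirical measures of points of the ball lie in `momentBall V R`, which is weakly compact by
Markov and Prokhorov. On a compact set the LDP reduces to bounds on neighbourhoods of single points
(`satisfiesLDP_of_local_bounds`). For the upper bound (`local_upper_bound`), an exponential
Chebyshev inequality under Lebesgue measure is used with a test function `f`. Donsker–Varadhan
suggests `f = g + α V` with `g` bounded continuous; it is truncated to be `o(V)`, because only then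
is `∫ f dμ` weakly continuous on the moment ball (`exists_test_function`, `continuousOn_integral`).
For the lower bound (`eventually_le_volume`), i.i.d. samples from `μ` satisfy, by the law of large
numbers, density, moment and empirical-measure constraints with probability at least `1/2`. A slight
contraction then puts them in the ball, even if `m_V(μ) = R`.

If `W = o(V)`, the `W`-moment is weakly continuous on the moment ball, so there the topology of
`d_W` is the weak one and the same bounds serve. For uniqueness of the parameter, a zero of one rate
function is a zero of every other; the Gibbs measure for `α` is such a zero, hence equals the one
for `β`. -/

namespace OrliczLDP

open InformationTheory
open scoped Pointwise

variable {V : ℝ → ℝ}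

/-! ### Elementary properties of Orlicz functions. -/

theorem IsOrlicz.nonneg (hV : IsOrlicz V) (x : ℝ) : 0 ≤ V x := by
  rcases eq_or_ne x 0 with rfl | hx
  · exact hV.zero.ge
  · exact (hV.pos x hx).le

theorem IsOrlicz.continuous (hV : IsOrlicz V) : Continuous V := by
  have := hV.convex.continuousOn_interior
  rw [interior_univ] at this
  exact continuousOn_univ.1 this

theorem IsOrlicz.measurable (hV : IsOrlicz V) : Measurable V := hV.continuous.measurable

theorem IsOrlicz.smul_le (hV : IsOrlicz V) {t : ℝ} (h0 : 0 ≤ t) (h1 : t ≤ 1) (x : ℝ) :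
    V (t * x) ≤ t * V x := by
  have := hV.convex.2 (Set.mem_univ x) (Set.mem_univ 0) h0 (sub_nonneg.2 h1) (by ring)
  simpa [hV.zero] using this

theorem IsOrlicz.abs_eq (hV : IsOrlicz V) (x : ℝ) : V |x| = V x := by
  rcases abs_choice x with h | h <;> rw [h]
  exact hV.even x

theorem IsOrlicz.le_of_abs_le (hV : IsOrlicz V) {x y : ℝ} (h : |x| ≤ |y|) : V x ≤ V y := by
  rw [← hV.abs_eq x, ← hV.abs_eq y]
  rcases (abs_nonneg y).eq_or_lt with hy | hy
  · have : |x| = 0 := le_antisymm (hy ▸ h) (abs_nonneg x)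
    rw [this, ← hy]
  · have := hV.smul_le (div_nonneg (abs_nonneg x) hy.le) (div_le_one_of_le₀ h hy.le) |y|
    rw [div_mul_cancel₀ _ hy.ne'] at this
    exact this.trans (mul_le_of_le_one_left (hV.nonneg _) (div_le_one_of_le₀ h hy.le))

/-- Convexity with `V 0 = 0` gives `V x ≥ V 1 * |x|` once `|x| ≥ 1`; the added constant covers the
rest. This linear growth yields integrability of `exp (β V)` and compact sublevel sets. -/
theorem IsOrlicz.linear_le (hV : IsOrlicz V) (x : ℝ) : V 1 * |x| ≤ V x + V 1 := by
  have h1 := hV.nonneg 1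
  rcases le_total |x| 1 with h | h
  · nlinarith [hV.nonneg x]
  · have hx : 0 < |x| := by linarith
    have := hV.smul_le (inv_nonneg.2 hx.le) (inv_le_one_of_one_le₀ h) |x|
    rw [inv_mul_cancel₀ hx.ne', hV.abs_eq, inv_mul_eq_div, le_div_iff₀ hx] at this
    linarith

/-! ### Gibbs measures and the choice of the parameter. -/

theorem integrable_exp_neg_mul_abs {b : ℝ} (hb : 0 < b) :
    Integrable fun x : ℝ => Real.exp (-b * |x|) := by
  have h : IntegrableOn (fun x : ℝ => Real.exp (-b * |x|)) (Set.Ioi 0) :=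
    (exp_neg_integrableOn_Ioi 0 hb).congr_fun
      (fun x hx => by simp [abs_of_pos (Set.mem_Ioi.1 hx)]) measurableSet_Ioi
  have h' : IntegrableOn (fun x : ℝ => Real.exp (-b * |x|)) (Set.Iic 0) :=
    (integrableOn_exp_mul_Iic hb 0).congr_fun
      (fun x hx => by simp [abs_of_nonpos (Set.mem_Iic.1 hx)]) measurableSet_Iic
  rw [← integrableOn_univ, ← Set.Iic_union_Ioi (a := (0:ℝ))]
  exact h'.union h

theorem IsOrlicz.integrable_exp (hV : IsOrlicz V) {β : ℝ} (hβ : β < 0) :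
    Integrable fun x => Real.exp (β * V x) := by
  have h1 := hV.pos 1 one_ne_zero
  refine ((integrable_exp_neg_mul_abs (b := -β * V 1) (by nlinarith)).const_mul
    (Real.exp (-β * V 1))).mono' ?_ (ae_of_all _ fun x => ?_)
  · exact (hV.continuous.const_mul β).rexp.aestronglyMeasurable
  · rw [Real.norm_of_nonneg (Real.exp_pos _).le, ← Real.exp_add]
    apply Real.exp_le_exp.2
    nlinarith [hV.linear_le x]

/-- The partition function `∫ exp (β V t) dt`. -/
noncomputable def partition (V : ℝ → ℝ) (β : ℝ) : ℝ := ∫ t, Real.exp (β * V t)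

theorem gibbs_eq (V : ℝ → ℝ) (β : ℝ) : gibbs V β = (volume : Measure ℝ).withDensity
    fun x => ENNReal.ofReal (Real.exp (β * V x) / partition V β) := rfl

theorem IsOrlicz.partition_pos (hV : IsOrlicz V) {β : ℝ} (hβ : β < 0) : 0 < partition V β :=
  integral_exp_pos (hV.integrable_exp hβ)

theorem IsOrlicz.isProbabilityMeasure_gibbs (hV : IsOrlicz V) {β : ℝ} (hβ : β < 0) :
    IsProbabilityMeasure (gibbs V β) := by
  refine ⟨?_⟩
  rw [gibbs_eq, withDensity_apply _ MeasurableSet.univ, Measure.restrict_univ,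
    ← ofReal_integral_eq_lintegral_ofReal ((hV.integrable_exp hβ).div_const _)
    (ae_of_all _ fun x => div_nonneg (Real.exp_pos _).le (hV.partition_pos hβ).le), integral_div]
  exact ENNReal.ofReal_eq_one.2 (div_self (hV.partition_pos hβ).ne')

/-- The densities are continuous, hence agree everywhere. Their values at `0` identify the
normalizations, and those at `1` the exponents. -/
theorem IsOrlicz.gibbs_injective (hV : IsOrlicz V) {α β : ℝ} (hα : α < 0) (hβ : β < 0)
    (h : gibbs V α = gibbs V β) : α = β := by
  have hc : ∀ γ : ℝ, Continuous fun x => Real.exp (γ * V x) / partition V γ := fun γ =>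
    (hV.continuous.const_mul γ).rexp.div_const _
  have hae : (fun x => Real.exp (α * V x) / partition V α)
      =ᵐ[volume] fun x => Real.exp (β * V x) / partition V β := by
    have h2 := (withDensity_eq_iff_of_sigmaFinite (μ := (volume : Measure ℝ))
      (hc α).measurable.ennreal_ofReal.aemeasurable
      (hc β).measurable.ennreal_ofReal.aemeasurable).1 h
    filter_upwards [h2] with x hx
    exact (ENNReal.ofReal_eq_ofReal_iff
      (div_nonneg (Real.exp_pos _).le (hV.partition_pos hα).le)
      (div_nonneg (Real.exp_pos _).le (hV.partition_pos hβ).le)).1 hx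
  have heq := Continuous.ae_eq_iff_eq volume (hc α) (hc β) |>.1 hae
  have h0 := congrFun heq 0
  have h1 := congrFun heq 1
  simp only [hV.zero, mul_zero, Real.exp_zero] at h0
  have hZ : partition V α = partition V β := by
    rw [one_div, one_div] at h0
    exact inv_injective h0
  simp only [hZ] at h1
  rw [div_left_inj' (hV.partition_pos hβ).ne', Real.exp_eq_exp] at h1
  exact mul_right_cancel₀ (hV.pos 1 one_ne_zero).ne' h1

/-- The integral is the derivative of `F β = ∫ exp (β (V - R))`, the moment generating function of
`V - R` under Lebesgue measure. Near both ends of `(-∞, 0)` the value of `F` is at least `F (-1)`,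
so a minimum is attained inside. -/
theorem IsOrlicz.exists_integral_eq_zero (hV : IsOrlicz V) {R : ℝ} (hR : 0 < R) :
    ∃ α < 0, Integrable (fun x => (V x - R) * Real.exp (α * (V x - R))) ∧
      ∫ x, (V x - R) * Real.exp (α * (V x - R)) = 0 := by
  set Y : ℝ → ℝ := fun x => V x - R with hY
  have hYc : Continuous Y := hV.continuous.sub continuous_const
  have hint : ∀ β < 0, Integrable fun x => Real.exp (β * Y x) := fun β hβ => by
    refine ((hV.integrable_exp hβ).mul_const (Real.exp (-β * R))).congr (ae_of_all _ fun x => ?_)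
    simp only [hY, ← Real.exp_add]
    ring_nf
  have hsub : Set.Iio 0 ⊆ integrableExpSet Y volume := fun β hβ => hint β hβ
  have hinter : ∀ β < 0, β ∈ interior (integrableExpSet Y volume) := fun β hβ =>
    interior_maximal hsub isOpen_Iio hβ
  set F := mgf Y volume with hF
  have hd : ∀ β < 0, HasDerivAt F (∫ x, Y x * Real.exp (β * Y x)) β := fun β hβ =>
    hasDerivAt_mgf (hinter β hβ)
  -- a lower bound for `F` by the contribution of a symmetric interval
  have hlow : ∀ β < 0, ∀ L > 0, 2 * L * Real.exp (β * (V L - R)) ≤ F β := fun β hβ L hL => by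
    have h1 : ∫ x in Set.Icc (-L) L, Real.exp (β * (V L - R)) ≤
        ∫ x in Set.Icc (-L) L, Real.exp (β * Y x) := by
      refine setIntegral_mono_on (integrableOn_const (by simp)) (hint β hβ).integrableOn
        measurableSet_Icc fun x hx => Real.exp_le_exp.2 ?_
      have : V x ≤ V L := hV.le_of_abs_le (by rw [abs_of_pos hL]; exact abs_le.2 hx)
      simp only [hY]
      nlinarith
    have h2 : ∫ x in Set.Icc (-L) L, Real.exp (β * Y x) ≤ F β :=
      setIntegral_le_integral (hint β hβ) (ae_of_all _ fun x => (Real.exp_pos _).le)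
    refine le_trans (le_of_eq ?_) (h1.trans h2)
    rw [setIntegral_const, smul_eq_mul, Measure.real, Real.volume_Icc, ENNReal.toReal_ofReal
      (by linarith)]
    ring
  -- On `[-η, η]` one has `V - R ≤ -R / 2`, which makes `F` blow up as `β → -∞`.
  obtain ⟨η, hη, hVη⟩ : ∃ η > 0, V η ≤ R / 2 := by
    have : ∀ᶠ x in 𝓝 0, V x < R / 2 :=
      hV.continuous.continuousAt.eventually_lt continuousAt_const (by rw [hV.zero]; linarith)
    obtain ⟨ε, hε, h⟩ := Metric.eventually_nhds_iff.1 this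
    refine ⟨ε / 2, by linarith, (h ?_).le⟩
    simp [abs_of_pos hε, hε]
  have hF0 : 0 < F (-1) := lt_of_lt_of_le (by positivity) (hlow (-1) (by norm_num) 1 one_pos)
  -- far to the left `F` is larger than `F (-1)`
  obtain ⟨A, hA1, hA⟩ : ∃ A < -1, ∀ β ≤ A, F (-1) ≤ F β := by
    have ht : Tendsto (fun s : ℝ => 2 * η * Real.exp (s * (R / 2))) atTop atTop :=
      Tendsto.const_mul_atTop (by positivity)
        (Real.tendsto_exp_atTop.comp (tendsto_id.atTop_mul_const (by linarith)))
    obtain ⟨s, hs⟩ := (ht.eventually_ge_atTop (F (-1))).exists_forall_of_atTop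
    refine ⟨-max s 2, by linarith [le_max_right s 2], fun β hβ => ?_⟩
    have hβs : s ≤ -β := by linarith [le_max_left s 2]
    have hβ0 : β < 0 := by linarith [le_max_right s 2]
    refine (hs (-β) hβs).trans (le_trans ?_ (hlow β hβ0 η hη))
    gcongr 2 * η * Real.exp ?_
    nlinarith
  -- Near `0` the blow-up comes from the infinite mass of Lebesgue measure: with `L = F (-1) + 1`
  -- and `β V L ≥ -1/2`, the integrand is at least `1/2` on `[-L, L]`.
  obtain ⟨B, hB1, hB0, hB⟩ : ∃ B, -1 < B ∧ B < 0 ∧ ∀ β, B ≤ β → β < 0 → F (-1) ≤ F β := by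
    have hL : 0 < F (-1) + 1 := by linarith
    set L := F (-1) + 1
    have hVL := hV.pos L hL.ne'
    refine ⟨-(1 / 2) * min 1 (1 / V L), ?_, ?_, fun β hβ hβ0 => ?_⟩
    · have := min_le_left 1 (1 / V L)
      linarith
    · have : 0 < min 1 (1 / V L) := lt_min one_pos (by positivity)
      linarith
    · refine le_trans ?_ (hlow β hβ0 L hL)
      have h1 : -(1 / 2) * (1 / V L) ≤ β :=
        le_trans (by have := min_le_right 1 (1 / V L); linarith) hβ
      have h2 : -(1 / 2) ≤ β * V L := by
        have := mul_le_mul_of_nonneg_right h1 hVL.le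
        rwa [mul_assoc, one_div_mul_cancel hVL.ne', mul_one] at this
      have h3 : 1 / 2 ≤ Real.exp (β * (V L - R)) := by
        have := Real.add_one_le_exp (β * (V L - R))
        nlinarith
      have : F (-1) ≤ L := by simp [L]
      nlinarith
  have hcont : ContinuousOn F (Set.Icc A B) := fun β hβ =>
    (hd β (hβ.2.trans_lt hB0)).continuousAt.continuousWithinAt
  have hm1 : (-1 : ℝ) ∈ Set.Icc A B := ⟨hA1.le, hB1.le⟩
  obtain ⟨α, hα, hmin⟩ := isCompact_Icc.exists_isMinOn ⟨_, hm1⟩ hcont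
  have hglob : ∀ β < 0, F α ≤ F β := fun β hβ => by
    by_cases h1 : A ≤ β
    · by_cases h2 : β ≤ B
      · exact hmin ⟨h1, h2⟩
      · exact (hmin hm1).trans (hB β (not_le.1 h2).le hβ)
    · exact (hmin hm1).trans (hA β (not_le.1 h1).le)
  have hα0 : α < 0 := hα.2.trans_lt hB0
  refine ⟨α, hα0, ?_, ?_⟩
  · simpa using integrable_pow_mul_exp_of_mem_interior_integrableExpSet (hinter α hα0) 1
  · refine IsLocalMin.hasDerivAt_eq_zero ?_ (hd α hα0)
    filter_upwards [Iio_mem_nhds hα0] with β hβ using hglob β hβ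

/-- The value `α` for which the Gibbs measure has `V`-moment `R`. -/
theorem IsOrlicz.exists_lintegral_gibbs_eq (hV : IsOrlicz V) {R : ℝ} (hR : 0 < R) :
    ∃ α < 0, ∫⁻ x, ENNReal.ofReal (V x) ∂(gibbs V α) = ENNReal.ofReal R := by
  obtain ⟨α, hα, hi, h0⟩ := hV.exists_integral_eq_zero hR
  refine ⟨α, hα, ?_⟩
  have hZ := hV.partition_pos hα
  have hi' : Integrable fun x => (V x - R) * Real.exp (α * V x) := by
    refine (hi.mul_const (Real.exp (α * R))).congr (ae_of_all _ fun x => ?_)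
    simp only [mul_assoc, ← Real.exp_add]
    ring_nf
  have h0' : ∫ x, (V x - R) * Real.exp (α * V x) = 0 := by
    have : ∫ x, (V x - R) * Real.exp (α * V x) =
        ∫ x, (V x - R) * Real.exp (α * (V x - R)) * Real.exp (α * R) := by
      congr 1 with x
      simp only [mul_assoc, ← Real.exp_add]
      ring_nf
    rw [this, integral_mul_const, h0, zero_mul]
  have hR' : Integrable fun x => R * Real.exp (α * V x) := (hV.integrable_exp hα).const_mul R
  have hVi : Integrable fun x => V x * Real.exp (α * V x) := by
    refine (hi'.add hR').congr (ae_of_all _ fun x => ?_)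
    simp only [Pi.add_apply]
    ring
  have hVint : ∫ x, V x * Real.exp (α * V x) = R * partition V α := by
    have : ∫ x, (V x - R) * Real.exp (α * V x) =
        ∫ x, (V x * Real.exp (α * V x) - R * Real.exp (α * V x)) := by
      congr 1 with x
      ring
    rw [this, integral_sub hVi hR', integral_const_mul] at h0'
    rw [partition]
    linarith
  have hc : Measurable fun x => ENNReal.ofReal (Real.exp (α * V x) / partition V α) :=
    ((hV.continuous.const_mul α).rexp.div_const _).measurable.ennreal_ofReal
  rw [gibbs_eq, lintegral_withDensity_eq_lintegral_mul _ hc hV.measurable.ennreal_ofReal]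
  have : ∀ x, ((fun x => ENNReal.ofReal (Real.exp (α * V x) / partition V α)) *
      fun x => ENNReal.ofReal (V x)) x =
      ENNReal.ofReal (V x * Real.exp (α * V x) / partition V α) := fun x => by
    rw [Pi.mul_apply,
      ← ENNReal.ofReal_mul (div_nonneg (Real.exp_pos _).le hZ.le)]
    congr 1
    ring
  simp_rw [this]
  rw [← ofReal_integral_eq_lintegral_ofReal (hVi.div_const _) (ae_of_all _ fun x =>
    div_nonneg (mul_nonneg (hV.nonneg x) (Real.exp_pos _).le) hZ.le), integral_div, hVint,
    mul_div_cancel_right₀ _ hZ.ne']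

/-! ### Moment balls: compactness and continuity of integrals. -/

/-- The set of probability measures with `V`-moment at most `R`. -/
def momentBall (V : ℝ → ℝ) (R : ℝ) : Set (ProbabilityMeasure ℝ) :=
  {μ | moment V μ ≤ ENNReal.ofReal R}

theorem IsOrlicz.integrable_of_mem_momentBall (hV : IsOrlicz V) {R : ℝ} {μ : ProbabilityMeasure ℝ}
    (hμ : μ ∈ momentBall V R) : Integrable V (μ : Measure ℝ) :=
  (lintegral_ofReal_ne_top_iff_integrable hV.continuous.aestronglyMeasurable
    (ae_of_all _ hV.nonneg)).1 (ne_top_of_le_ne_top ENNReal.ofReal_ne_top hμ)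

theorem IsOrlicz.integral_eq_toReal_moment (hV : IsOrlicz V) (μ : ProbabilityMeasure ℝ) :
    ∫ x, V x ∂(μ : Measure ℝ) = (moment V μ).toReal :=
  integral_eq_lintegral_of_nonneg_ae (ae_of_all _ hV.nonneg) hV.continuous.aestronglyMeasurable

theorem IsOrlicz.integral_le_of_mem_momentBall (hV : IsOrlicz V) {R : ℝ} (hR : 0 < R)
    {μ : ProbabilityMeasure ℝ} (hμ : μ ∈ momentBall V R) : ∫ x, V x ∂(μ : Measure ℝ) ≤ R := by
  rw [hV.integral_eq_toReal_moment]
  exact ENNReal.toReal_le_of_le_ofReal hR.le hμ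

/-- A continuous function with values in `[-M, M]`, as a bounded continuous function. -/
def boundedOfAbsLe (f : ℝ → ℝ) (hf : Continuous f) (M : ℝ) (hM : ∀ x, |f x| ≤ M) :
    BoundedContinuousFunction ℝ ℝ :=
  BoundedContinuousFunction.ofNormedAddCommGroup f hf M hM

theorem continuous_integral_of_abs_le (f : ℝ → ℝ) (hf : Continuous f) (M : ℝ)
    (hM : ∀ x, |f x| ≤ M) :
    Continuous fun μ : ProbabilityMeasure ℝ => ∫ x, f x ∂(μ : Measure ℝ) :=
  ProbabilityMeasure.continuous_integral_boundedContinuousFunction (boundedOfAbsLe f hf M hM)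

/-- By monotone convergence the moment constraint is the conjunction over `N` of the weakly closed
constraints on `min (V x) N`. -/
theorem IsOrlicz.isClosed_momentBall (hV : IsOrlicz V) {R : ℝ} (hR : 0 < R) :
    IsClosed (momentBall V R) := by
  have hb : ∀ (N : ℕ) x, |min (V x) N| ≤ N := fun N x => by
    rw [abs_of_nonneg (le_min (hV.nonneg x) N.cast_nonneg)]
    exact min_le_right _ _
  have hc : ∀ N : ℕ, Continuous fun x => min (V x) (N : ℝ) := fun N =>
    hV.continuous.min continuous_const
  have hcont := fun N : ℕ => continuous_integral_of_abs_le _ (hc N) N (hb N)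
  have : momentBall V R =
      ⋂ N : ℕ, {μ : ProbabilityMeasure ℝ | ∫ x, min (V x) (N : ℝ) ∂(μ : Measure ℝ) ≤ R} := by
    ext μ
    have hi : ∀ N : ℕ, Integrable (fun x => min (V x) (N : ℝ)) (μ : Measure ℝ) := fun N =>
      Integrable.of_bound (hc N).aestronglyMeasurable N (ae_of_all _ (hb N))
    simp only [Set.mem_iInter, momentBall, Set.mem_ofPred_eq]
    refine ⟨fun h N => ?_, fun h => ?_⟩
    · exact (integral_mono (hi N) (hV.integrable_of_mem_momentBall h)
        (fun x => min_le_left _ _)).trans (hV.integral_le_of_mem_momentBall hR h)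
    · have ht : Tendsto (fun N : ℕ => ∫⁻ x, ENNReal.ofReal (min (V x) (N : ℝ)) ∂(μ : Measure ℝ))
          atTop (𝓝 (moment V μ)) := by
        refine lintegral_tendsto_of_tendsto_of_monotone
          (fun N => (hc N).measurable.ennreal_ofReal.aemeasurable)
          (ae_of_all _ fun x N M hNM => ENNReal.ofReal_le_ofReal
            (min_le_min_left _ (Nat.cast_le.2 hNM))) (ae_of_all _ fun x => ?_)
        refine tendsto_const_nhds.congr' ?_
        obtain ⟨N, hN⟩ := exists_nat_ge (V x)
        filter_upwards [eventually_ge_atTop N] with M hM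
        rw [min_eq_left (hN.trans (Nat.cast_le.2 hM))]
      refine le_of_tendsto' ht fun N => ?_
      rw [← ofReal_integral_eq_lintegral_ofReal (hi N)
        (ae_of_all _ fun x => le_min (hV.nonneg x) N.cast_nonneg)]
      exact ENNReal.ofReal_le_ofReal (h N)
  rw [this]
  exact isClosed_iInter fun N => isClosed_le (hcont N) continuous_const

theorem IsOrlicz.isCompact_sublevel (hV : IsOrlicz V) (M : ℝ) : IsCompact {x | V x ≤ M} := by
  refine Metric.isCompact_of_isClosed_isBounded (isClosed_le hV.continuous continuous_const)
    ((Metric.isBounded_closedBall (x := (0:ℝ)) (r := (M + V 1) / V 1)).subset fun x hx => ?_)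
  rw [mem_closedBall_zero_iff, Real.norm_eq_abs, le_div_iff₀ (hV.pos 1 one_ne_zero)]
  have h : V x ≤ M := hx
  linarith [hV.linear_le x]

/-- Markov's inequality leaves mass at most `1 / (n + 1)` outside the compact set `{V ≤ R (n + 1)}`,
so the family is tight and Prokhorov's theorem applies. -/
theorem IsOrlicz.isCompact_momentBall (hV : IsOrlicz V) {R : ℝ} (hR : 0 < R) :
    IsCompact (momentBall V R) := by
  have hu : Tendsto (fun n : ℕ => ((n : ℝ≥0) + 1)⁻¹) atTop (𝓝 0) := by
    have := tendsto_one_div_add_atTop_nhds_zero_nat (𝕜 := ℝ)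
    rw [← NNReal.tendsto_coe]
    simpa using this
  refine (isCompact_setOfPred_probabilityMeasure_mass_eq_compl_isCompact_le hu
    (fun n : ℕ => hV.isCompact_sublevel (R * (n + 1))) (Or.inl inferInstance)).of_isClosed_subset
    (hV.isClosed_momentBall hR) fun μ hμ n => ?_
  have hn : (0 : ℝ) < n + 1 := by positivity
  have h1 : (μ : Measure ℝ) {x | V x ≤ R * (n + 1)}ᶜ ≤ ENNReal.ofReal ((n + 1)⁻¹) := by
    refine (measure_mono fun x hx => ?_).trans ((meas_ge_le_lintegral_div
      hV.measurable.ennreal_ofReal.aemeasurable (ε := ENNReal.ofReal (R * (n + 1)))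
      (by simp; positivity) ENNReal.ofReal_ne_top).trans ?_)
    · have hx' : ¬ V x ≤ R * (n + 1) := hx
      exact ENNReal.ofReal_le_ofReal (not_le.1 hx').le
    · refine (ENNReal.div_le_div_right hμ _).trans ?_
      rw [← ENNReal.ofReal_div_of_pos (by positivity)]
      refine ENNReal.ofReal_le_ofReal (le_of_eq ?_)
      field_simp
  rw [← ENNReal.coe_le_coe, ProbabilityMeasure.ennreal_coeFn_eq_coeFn_toMeasure]
  refine h1.trans (le_of_eq ?_)
  rw [ENNReal.ofReal]
  congr 1
  ext
  rw [Real.coe_toNNReal _ (by positivity)]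
  simp

theorem IsOrlicz.exists_abs_le_of_isLittleO (hV : IsOrlicz V) {φ : ℝ → ℝ} (hφ : Continuous φ)
    (ho : φ =o[Bornology.cobounded ℝ] V) {ε : ℝ} (hε : 0 < ε) :
    ∃ M, 0 ≤ M ∧ ∀ x, |φ x| ≤ M ∨ |φ x| ≤ ε * V x := by
  obtain ⟨T, -, hT⟩ := (hasBasis_cobounded_norm.eventually_iff).1 (Asymptotics.isLittleO_iff.1 ho hε)
  obtain ⟨M, hM⟩ := (isCompact_closedBall (0:ℝ) T).exists_bound_of_continuousOn hφ.continuousOn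
  refine ⟨max M 0, le_max_right _ _, fun x => ?_⟩
  rcases le_total ‖x‖ T with h | h
  · exact Or.inl ((hM x (mem_closedBall_zero_iff.2 h)).trans (le_max_left _ _))
  · have := hT h
    rw [Real.norm_of_nonneg (hV.nonneg x)] at this
    exact Or.inr this

theorem IsOrlicz.integrable_of_isLittleO (hV : IsOrlicz V) {R : ℝ} {φ : ℝ → ℝ}
    (hφ : Continuous φ) (ho : φ =o[Bornology.cobounded ℝ] V) {μ : ProbabilityMeasure ℝ}
    (hμ : μ ∈ momentBall V R) : Integrable φ (μ : Measure ℝ) := by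
  obtain ⟨M, hM0, hM⟩ := hV.exists_abs_le_of_isLittleO hφ ho one_pos
  refine ((integrable_const M).add (hV.integrable_of_mem_momentBall hμ)).mono'
    hφ.aestronglyMeasurable (ae_of_all _ fun x => ?_)
  have := hV.nonneg x
  simp only [Pi.add_apply, Real.norm_eq_abs]
  rcases hM x with h | h <;> linarith

/-- Functions that are small compared to `V` at infinity have integrals that depend
continuously on the measure, as long as the `V`-moment stays bounded. -/
theorem IsOrlicz.continuousOn_integral (hV : IsOrlicz V) {R : ℝ} (hR : 0 < R) {φ : ℝ → ℝ}
    (hφ : Continuous φ) (ho : φ =o[Bornology.cobounded ℝ] V) :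
    ContinuousOn (fun μ : ProbabilityMeasure ℝ => ∫ x, φ x ∂(μ : Measure ℝ)) (momentBall V R) := by
  refine continuousOn_of_uniform_approx_of_continuousOn fun u hu => ?_
  obtain ⟨δ, hδ, hδu⟩ := Metric.mem_uniformity_dist.1 hu
  -- Clamping `φ` to `[-M, M]` costs at most `ε V` pointwise, hence at most `ε R = δ / 2` in
  -- integral, uniformly on the moment ball.
  have hε : 0 < δ / (2 * R) := by positivity
  obtain ⟨M, hM0, hM⟩ := hV.exists_abs_le_of_isLittleO hφ ho hε
  have hψ : Continuous fun x => max (-M) (min M (φ x)) :=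
    continuous_const.max (continuous_const.min hφ)
  have hψM : ∀ x, |max (-M) (min M (φ x))| ≤ M := fun x =>
    abs_le.2 ⟨le_max_left _ _, max_le (by linarith) (min_le_left _ _)⟩
  refine ⟨fun μ => ∫ x, max (-M) (min M (φ x)) ∂(μ : Measure ℝ),
    (continuous_integral_of_abs_le _ hψ M hψM).continuousOn, fun μ hμ => hδu ?_⟩
  have hi : Integrable (fun x => max (-M) (min M (φ x))) (μ : Measure ℝ) :=
    Integrable.of_bound hψ.aestronglyMeasurable M (ae_of_all _ hψM)
  rw [Real.dist_eq, ← integral_sub (hV.integrable_of_isLittleO hφ ho hμ) hi]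
  have hpt : ∀ x, |φ x - max (-M) (min M (φ x))| ≤ δ / (2 * R) * V x := fun x => by
    have h0 : 0 ≤ δ / (2 * R) * V x := mul_nonneg hε.le (hV.nonneg x)
    rcases hM x with h | h
    · rw [min_eq_right (abs_le.1 h).2, max_eq_right (abs_le.1 h).1]
      simpa using h0
    · refine le_trans ?_ h
      rcases le_total (φ x) M with h1 | h1 <;> rcases le_total (-M) (φ x) with h2 | h2
      · simp [min_eq_right h1, max_eq_right h2]
      · rw [min_eq_right h1, max_eq_left h2, abs_of_nonpos (by linarith),
          abs_of_nonpos (by linarith)]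
        linarith
      · rw [min_eq_left h1, max_eq_right (by linarith), abs_of_nonneg (by linarith),
          abs_of_nonneg (by linarith)]
        linarith
      · rw [min_eq_left h1, max_eq_right (by linarith), abs_of_nonneg (by linarith),
          abs_of_nonneg (by linarith)]
        linarith
  calc |∫ x, (φ x - max (-M) (min M (φ x))) ∂(μ : Measure ℝ)|
      ≤ ∫ x, δ / (2 * R) * V x ∂(μ : Measure ℝ) := by
        rw [← Real.norm_eq_abs]
        exact norm_integral_le_of_norm_le ((hV.integrable_of_mem_momentBall hμ).const_mul _)
          (ae_of_all _ hpt)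
    _ = δ / (2 * R) * ∫ x, V x ∂(μ : Measure ℝ) := integral_const_mul _ _
    _ ≤ δ / (2 * R) * R :=
        mul_le_mul_of_nonneg_left (hV.integral_le_of_mem_momentBall hR hμ) hε.le
    _ < δ := by
        have : δ / (2 * R) * R = δ / 2 := by field_simp
        linarith

/-! ### Empirical measures. -/

theorem integral_empirical (f : ℝ → ℝ) (n : ℕ+) (x : Fin n → ℝ) :
    ∫ y, f y ∂(empirical n x : Measure ℝ) = ((n : ℕ) : ℝ)⁻¹ * ∑ i, f (x i) := by
  have : (empirical n x : Measure ℝ) =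
      ((n : ℕ) : ℝ≥0∞)⁻¹ • ∑ i, Measure.dirac (x i) := rfl
  rw [this, integral_smul_measure, integral_finsetSum_measure fun i _ => integrable_dirac (by simp)]
  simp

theorem continuous_empirical (n : ℕ+) : Continuous (empirical n) := by
  refine ProbabilityMeasure.continuous_iff_forall_continuous_integral.2 fun f => ?_
  simp_rw [integral_empirical]
  fun_prop

theorem IsOrlicz.empirical_mem_momentBall_iff (hV : IsOrlicz V) {R : ℝ} (hR : 0 < R) (n : ℕ+)
    (x : Fin n → ℝ) : empirical n x ∈ momentBall V R ↔ x ∈ orliczBall V R n := by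
  have h := moment_empirical_lt_top V n x
  have hn : (0 : ℝ) < (n : ℕ) := Nat.cast_pos.2 n.pos
  rw [momentBall, Set.mem_ofPred_eq, ENNReal.le_ofReal_iff_toReal_le h.ne hR.le,
    ← hV.integral_eq_toReal_moment, integral_empirical, orliczBall, Set.mem_ofPred_eq,
    inv_mul_le_iff₀ hn, mul_comm R]

/-! ### The exponential scale, and the LDP from local bounds. -/

theorem logScale_mono (n : ℕ+) : Monotone (logScale n) := fun p q h =>
  mul_le_mul_of_nonneg_left (ENNReal.log_monotone h) (by
    rw [← EReal.coe_zero, EReal.coe_le_coe_iff]; positivity)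

theorem logScale_exp (n : ℕ+) (c : ℝ) :
    logScale n (ENNReal.ofReal (Real.exp (-((n : ℕ) * c)))) = ((-c : ℝ) : EReal) := by
  have hn : ((n : ℕ) : ℝ) ≠ 0 := Nat.cast_ne_zero.2 n.ne_zero
  rw [logScale, ENNReal.log_ofReal_of_pos (Real.exp_pos _), Real.log_exp, ← EReal.coe_mul]
  congr 1
  field_simp

theorem logScale_one (n : ℕ+) : logScale n 1 = 0 := by
  simp [logScale]

theorem tendsto_pnat_cast_atTop : Tendsto (fun n : ℕ+ => ((n : ℕ) : ℝ)) atTop atTop :=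
  tendsto_natCast_atTop_atTop.comp tendsto_PNat_val_atTop_atTop

theorem eventually_natCast_mul_exp_le (N : ℕ) {c d : ℝ} (h : c < d) :
    ∀ᶠ n : ℕ+ in atTop, N * ENNReal.ofReal (Real.exp (-((n : ℕ) * d))) ≤
      ENNReal.ofReal (Real.exp (-((n : ℕ) * c))) := by
  have ht : Tendsto (fun n : ℕ+ => Real.exp (((n : ℕ) : ℝ) * (d - c))) atTop atTop :=
    Real.tendsto_exp_atTop.comp (tendsto_pnat_cast_atTop.atTop_mul_const (sub_pos.2 h))
  filter_upwards [ht.eventually_ge_atTop (N : ℝ)] with n hn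
  rw [← ENNReal.ofReal_natCast, ← ENNReal.ofReal_mul N.cast_nonneg]
  refine ENNReal.ofReal_le_ofReal ?_
  calc (N : ℝ) * Real.exp (-((n : ℕ) * d))
      ≤ Real.exp (((n : ℕ) : ℝ) * (d - c)) * Real.exp (-((n : ℕ) * d)) := by gcongr
    _ = Real.exp (-((n : ℕ) * c)) := by rw [← Real.exp_add]; ring_nf

/-- A large deviation principle for variables with values in a compact set follows from local
upper and lower bounds. -/
theorem satisfiesLDP_of_local_bounds {X : Type*} [TopologicalSpace X] [T2Space X]
    {Ω : ℕ+ → Type*} [∀ n, MeasurableSpace (Ω n)] {P : ∀ n, Measure (Ω n)}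
    [∀ n, IsProbabilityMeasure (P n)] {ξ : ∀ n, Ω n → X} {I : X → ℝ≥0∞} {K : Set X}
    (hK : IsCompact K) (hξ : ∀ n, P n {ω | ξ n ω ∉ K} = 0) (hI : ∀ x ∉ K, I x = ∞)
    (hup : ∀ x ∈ K, ∀ c : ℝ, 0 ≤ c → ENNReal.ofReal c < I x → ∃ U ∈ 𝓝 x, ∀ᶠ n : ℕ+ in atTop,
      P n {ω | ξ n ω ∈ U} ≤ ENNReal.ofReal (Real.exp (-((n : ℕ) * c))))
    (hlow : ∀ x, ∀ c : ℝ, I x < ENNReal.ofReal c → ∀ U, IsOpen U → x ∈ U → ∀ᶠ n : ℕ+ in atTop,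
      ENNReal.ofReal (Real.exp (-((n : ℕ) * c))) ≤ P n {ω | ξ n ω ∈ U}) :
    SatisfiesLDP P ξ I where
  good := by
    intro c
    refine hK.of_isClosed_subset (isOpen_compl_iff.1 (isOpen_iff_mem_nhds.2 fun x hx => ?_))
      fun x hx => ?_
    · have hx' : (c : ℝ≥0∞) < I x := not_le.1 hx
      by_cases hxK : x ∈ K
      · obtain ⟨d', hcd', hd'⟩ := ENNReal.lt_iff_exists_nnreal_btwn.1 hx'
        obtain ⟨d, hcd, hdd'⟩ := exists_between (ENNReal.coe_lt_coe.1 hcd')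
        obtain ⟨U, hU, hUn⟩ := hup x hxK d' d'.2 (by rwa [ENNReal.ofReal_coe_nnreal])
        filter_upwards [interior_mem_nhds.2 hU] with y hy hyc
        have hyd : I y < ENNReal.ofReal d := by
          rw [ENNReal.ofReal_coe_nnreal]
          exact lt_of_le_of_lt hyc (ENNReal.coe_lt_coe.2 hcd)
        obtain ⟨n, hn1, hn2⟩ := (hUn.and (hlow y d hyd _ isOpen_interior hy)).exists
        have h := (hn2.trans (measure_mono fun ω hω =>
          show ξ n ω ∈ U from interior_subset hω)).trans hn1
        rw [ENNReal.ofReal_le_ofReal_iff (Real.exp_pos _).le, Real.exp_le_exp, neg_le_neg_iff] at h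
        have := le_of_mul_le_mul_left h (Nat.cast_pos.2 n.pos)
        exact absurd hdd' (not_lt.2 (NNReal.coe_le_coe.1 this))
      · exact mem_of_superset (hK.isClosed.isOpen_compl.mem_nhds hxK) fun y hy hyc =>
          absurd ((hI y hy).ge.trans hyc) (by simp)
    · by_contra hxK
      exact absurd ((hI x hxK).ge.trans hx) (by simp)
  lower := by
    intro A _
    rw [EReal.neg_le]
    refine le_iInf₂ fun x hx => ?_
    rw [EReal.neg_le]
    refine le_of_forall_lt_imp_le_of_dense fun a ha => ?_
    induction a using EReal.rec with
    | bot => exact bot_le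
    | top => exact absurd ha (not_lt.2 le_top)
    | coe a =>
      have hIa : I x < ENNReal.ofReal (-a) := by
        rw [EReal.lt_neg_comm] at ha
        rw [← EReal.coe_ennreal_lt_coe_ennreal_iff]
        refine lt_of_lt_of_le ha ?_
        rw [EReal.coe_ennreal_ofReal, ← EReal.coe_neg, EReal.coe_le_coe_iff]
        exact le_max_left _ _
      refine le_liminf_of_le (by isBoundedDefault) ?_
      filter_upwards [hlow x (-a) hIa _ isOpen_interior hx] with n hn
      have := logScale_mono n hn
      rwa [logScale_exp, neg_neg] at this
  middle := by
    intro A _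
    refine (liminf_le_limsup).trans (limsup_le_limsup (Eventually.of_forall fun n => ?_))
    exact logScale_mono n (measure_mono fun ω hω =>
      show ξ n ω ∈ closure A from subset_closure (interior_subset hω))
  upper := by
    intro A _
    refine le_of_forall_gt_imp_ge_of_dense fun a ha => ?_
    rcases le_or_gt 0 a with h0 | h0
    · refine le_trans (limsup_le_of_le (by isBoundedDefault) (Eventually.of_forall fun n => ?_)) h0
      rw [← logScale_one n]
      exact logScale_mono n prob_le_one
    -- The gap between `b` and `a` will absorb the number of sets in the finite cover.
    obtain ⟨b, hb, hba⟩ := exists_between ha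
    induction b using EReal.rec with
    | bot => exact absurd hb (not_lt.2 bot_le)
    | top => exact absurd hba (not_lt.2 le_top)
    | coe b =>
    induction a using EReal.rec with
    | bot => exact absurd hba (not_lt.2 bot_le)
    | top => exact absurd h0 (not_lt.2 le_top)
    | coe a =>
    have hba' : b < a := EReal.coe_lt_coe_iff.1 hba
    have ha0 : a < 0 := EReal.coe_lt_coe_iff.1 h0
    have hIb : ∀ x ∈ closure A, ENNReal.ofReal (-b) < I x := fun x hx => by
      rw [EReal.neg_lt_comm] at hb
      rw [← EReal.coe_ennreal_lt_coe_ennreal_iff]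
      refine lt_of_le_of_lt ?_ (lt_of_lt_of_le hb (iInf₂_le x hx))
      rw [EReal.coe_ennreal_ofReal, ← EReal.coe_neg, EReal.coe_le_coe_iff,
        max_eq_left (by linarith)]
    have hC : IsCompact (closure A ∩ K) := hK.inter_left isClosed_closure
    choose! U hU hUn using fun x (hx : x ∈ closure A ∩ K) =>
      hup x hx.2 (-b) (by linarith) (hIb x hx.1)
    obtain ⟨t, ht, htU⟩ := hC.elim_nhds_subcover U hU
    have hall : ∀ᶠ n in atTop, ∀ x ∈ t,
        P n {ω | ξ n ω ∈ U x} ≤ ENNReal.ofReal (Real.exp (-((n : ℕ) * -b))) :=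
      (Finset.eventually_all t).2 fun x hx => hUn x (ht x hx)
    refine limsup_le_of_le (by isBoundedDefault) ?_
    filter_upwards [hall, eventually_natCast_mul_exp_le t.card
      (show -a < -b by linarith)] with n hn1 hn2
    have : P n {ω | ξ n ω ∈ closure A} ≤ ENNReal.ofReal (Real.exp (-((n : ℕ) * -a))) := by
      refine le_trans ?_ hn2
      calc P n {ω | ξ n ω ∈ closure A}
          ≤ P n ((⋃ x ∈ t, {ω | ξ n ω ∈ U x}) ∪ {ω | ξ n ω ∉ K}) := by
            refine measure_mono fun ω hω => ?_
            by_cases h : ξ n ω ∈ K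
            · left
              have := htU ⟨hω, h⟩
              simpa using this
            · exact Or.inr h
        _ ≤ P n (⋃ x ∈ t, {ω | ξ n ω ∈ U x}) + P n {ω | ξ n ω ∉ K} := measure_union_le _ _
        _ ≤ ∑ x ∈ t, P n {ω | ξ n ω ∈ U x} := by
            rw [hξ n, add_zero]
            exact measure_biUnion_finset_le _ _
        _ ≤ ∑ x ∈ t, ENNReal.ofReal (Real.exp (-((n : ℕ) * -b))) := Finset.sum_le_sum hn1
        _ = _ := by rw [Finset.sum_const, nsmul_eq_mul]
    have h2 := logScale_mono n this
    rwa [logScale_exp, neg_neg] at h2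

/-! ### The variational formula for relative entropy. -/

/-- The optimal test function is the logarithm of `dμ/dν`; clamping the density to `[1/(N+1), N+1]`
makes it bounded, and Fatou's lemma recovers the entropy as `N → ∞`. The form `∫ g dμ - ∫ exp g dν +
1` is dual to `klFun` pointwise. -/
theorem exists_measurable_lt_of_lt_klDiv {X : Type*} [MeasurableSpace X] {μ ν : Measure X}
    [IsProbabilityMeasure μ] [IsProbabilityMeasure ν] {c : ℝ} (h : ENNReal.ofReal c < klDiv μ ν) :
    ∃ (g : X → ℝ) (M : ℝ), Measurable g ∧ (∀ x, |g x| ≤ M) ∧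
      c < ∫ x, g x ∂μ - ∫ x, Real.exp (g x) ∂ν + 1 := by
  by_cases hac : μ ≪ ν
  · set f : X → ℝ := fun x => (μ.rnDeriv ν x).toReal with hf
    have hfm : Measurable f := (Measure.measurable_rnDeriv μ ν).ennreal_toReal
    have hf0 : ∀ x, 0 ≤ f x := fun x => ENNReal.toReal_nonneg
    have hfi : Integrable f ν := Measure.integrable_toReal_rnDeriv
    set y : ℕ → X → ℝ := fun N x => max ((N + 1 : ℝ)⁻¹) (min (f x) (N + 1)) with hy
    have hym : ∀ N, Measurable (y N) := fun N => measurable_const.max (hfm.min measurable_const)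
    have hN1 : ∀ N : ℕ, (1 : ℝ) ≤ N + 1 := fun N => by
      have := N.cast_nonneg (α := ℝ)
      linarith
    have hinv : ∀ N : ℕ, ((N + 1 : ℝ)⁻¹) ≤ 1 := fun N => inv_le_one_of_one_le₀ (hN1 N)
    have hinv0 : ∀ N : ℕ, 0 < ((N + 1 : ℝ)⁻¹) := fun N => inv_pos.2 (by linarith [hN1 N])
    have hy0 : ∀ N x, 0 < y N x := fun N x => (hinv0 N).trans_le (le_max_left _ _)
    have hyN : ∀ N x, y N x ≤ N + 1 := fun N x =>
      max_le ((hinv N).trans (hN1 N)) (min_le_right _ _)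
    have hlog : ∀ N x, |Real.log (y N x)| ≤ Real.log (N + 1) := fun N x => by
      refine abs_le.2 ⟨?_, Real.log_le_log (hy0 N x) (hyN N x)⟩
      rw [← Real.log_inv]
      exact Real.log_le_log (hinv0 N) (le_max_left _ _)
    -- Clamping moves `f x` towards `1`, so `f - y` and `log y` have the same sign.
    have hmul : ∀ N x, 0 ≤ (f x - y N x) * Real.log (y N x) := fun N x => by
      simp only [hy]
      rcases le_total (f x) (N + 1) with h1 | h1
      · rw [min_eq_left h1]
        rcases le_total ((N + 1 : ℝ)⁻¹) (f x) with h2 | h2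
        · simp [max_eq_right h2]
        · rw [max_eq_left h2]
          exact mul_nonneg_of_nonpos_of_nonpos (by linarith)
            (Real.log_nonpos (hinv0 N).le (hinv N))
      · rw [min_eq_right h1, max_eq_right ((hinv N).trans (hN1 N))]
        exact mul_nonneg (by linarith) (Real.log_nonneg (hN1 N))
    -- `k N = klFun (y N) + (f - y N) * log (y N)` is nonnegative, as Fatou's lemma requires.
    set k : ℕ → X → ℝ := fun N x => f x * Real.log (y N x) - y N x + 1 with hk
    have hkm : ∀ N, Measurable (k N) := fun N =>
      ((hfm.mul (hym N).log).sub (hym N)).add measurable_const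
    have hk0 : ∀ N x, 0 ≤ k N x := fun N x => by
      have h1 := klFun_nonneg (hy0 N x).le
      rw [klFun_apply] at h1
      have h2 := hmul N x
      simp only [hk]
      linarith
    have hlim : ∀ x, Tendsto (fun N => k N x) atTop (𝓝 (klFun (f x))) := fun x => by
      rcases (hf0 x).eq_or_lt with h0 | h0
      · have : ∀ N, k N x = - (((N : ℝ) + 1)⁻¹) + 1 := fun N => by
          simp only [hk, hy, ← h0]
          rw [min_eq_left (by linarith [hN1 N]), max_eq_left (hinv0 N).le]
          ring
        simp_rw [this, ← h0, klFun_zero]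
        have h1 := (tendsto_one_div_add_atTop_nhds_zero_nat (𝕜 := ℝ)).neg.add_const 1
        simpa using h1
      · refine tendsto_const_nhds.congr' ?_
        obtain ⟨N, hN⟩ := exists_nat_ge (max (f x) (f x)⁻¹)
        filter_upwards [eventually_ge_atTop N] with m hm
        have hm' : (N : ℝ) ≤ m := Nat.cast_le.2 hm
        have h1 : f x ≤ m + 1 := by linarith [le_max_left (f x) (f x)⁻¹]
        have h2 : ((m : ℝ) + 1)⁻¹ ≤ f x := by
          rw [inv_le_comm₀ (by linarith [hN1 m]) h0]
          linarith [le_max_right (f x) (f x)⁻¹]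
        simp only [hk, hy, min_eq_left h1, max_eq_right h2, klFun_apply]
        ring
    rw [klDiv_eq_lintegral_klFun_of_ac hac] at h
    have hfatou : ∫⁻ x, ENNReal.ofReal (klFun (f x)) ∂ν ≤
        liminf (fun N => ∫⁻ x, ENNReal.ofReal (k N x) ∂ν) atTop := by
      refine le_trans (lintegral_mono fun x => le_of_eq ?_)
        (lintegral_liminf_le fun N => (hkm N).ennreal_ofReal)
      exact (((ENNReal.continuous_ofReal.tendsto _).comp (hlim x)).liminf_eq).symm
    obtain ⟨N, hN⟩ := (eventually_lt_of_lt_liminf (h.trans_le hfatou)).exists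
    have hgi : Integrable (fun x => f x * Real.log (y N x)) ν := by
      refine hfi.mul_bdd (c := Real.log (N + 1)) (hym N).log.aestronglyMeasurable
        (ae_of_all _ fun x => hlog N x)
    have hyi : Integrable (y N) ν := Integrable.of_bound (hym N).aestronglyMeasurable (N + 1)
      (ae_of_all _ fun x => by
        rw [Real.norm_of_nonneg (hy0 N x).le]
        exact hyN N x)
    refine ⟨fun x => Real.log (y N x), Real.log (N + 1), (hym N).log, hlog N, ?_⟩
    have h1 : ∫ x, Real.log (y N x) ∂μ = ∫ x, f x * Real.log (y N x) ∂ν :=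
      (integral_rnDeriv_smul hac).symm
    have h2 : ∫ x, Real.exp (Real.log (y N x)) ∂ν = ∫ x, y N x ∂ν :=
      integral_congr_ae (ae_of_all _ fun x => Real.exp_log (hy0 N x))
    have hki : Integrable (k N) ν := (hgi.sub hyi).add (integrable_const _)
    have h3 : ∫ x, k N x ∂ν = ∫ x, f x * Real.log (y N x) ∂ν - ∫ x, y N x ∂ν + 1 := by
      have h4 : ∫ x, k N x ∂ν = ∫ x, (f x * Real.log (y N x) - y N x) ∂ν + ∫ _x, (1 : ℝ) ∂ν :=
        integral_add (hgi.sub hyi) (integrable_const _)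
      rw [h4, integral_sub hgi hyi]
      simp
    rw [h1, h2, ← h3]
    rw [← ofReal_integral_eq_lintegral_ofReal hki (ae_of_all _ (hk0 N))] at hN
    exact (ENNReal.ofReal_lt_ofReal_iff'.1 hN).1
  · obtain ⟨A, hA, hνA, hμA⟩ : ∃ A, MeasurableSet A ∧ ν A = 0 ∧ μ A ≠ 0 := by
      by_contra! hcon
      exact hac (Measure.AbsolutelyContinuous.mk fun s hs h0 => hcon s hs h0)
    have hr : 0 < μ.real A := ENNReal.toReal_pos hμA (measure_ne_top _ _)
    -- In the singular case `g = M` on a `ν`-null set `A` is invisible to `ν`, while it contributes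
    -- `|c| + 1` under `μ`.
    set M := (|c| + 1) / μ.real A
    have hM : 0 ≤ M := by positivity
    refine ⟨A.indicator fun _ => M, M, measurable_const.indicator hA, fun x => ?_, ?_⟩
    · by_cases hx : x ∈ A <;> simp [hx, abs_of_nonneg hM, hM]
    · have h1 : ∫ x, Real.exp (A.indicator (fun _ => M) x) ∂ν = ∫ _x, (1 : ℝ) ∂ν := by
        refine integral_congr_ae ?_
        filter_upwards [measure_eq_zero_iff_ae_notMem.1 hνA] with x hx
        simp [hx]
      rw [h1, integral_indicator_const _ hA]
      have : μ.real A * M = |c| + 1 := mul_div_cancel₀ _ hr.ne'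
      simp only [integral_const, smul_eq_mul, this, probReal_univ]
      linarith [le_abs_self c]

theorem abs_exp_sub_exp_le {a b M : ℝ} (ha : a ≤ M) (hb : b ≤ M) :
    |Real.exp a - Real.exp b| ≤ Real.exp M * |a - b| := by
  have key : ∀ a b : ℝ, a ≤ M → b ≤ a → Real.exp a - Real.exp b ≤ Real.exp M * (a - b) := by
    intro a b ha hab
    have h1 := Real.add_one_le_exp (b - a)
    have h2 : Real.exp b = Real.exp a * Real.exp (b - a) := by rw [← Real.exp_add]; ring_nf
    have h3 : Real.exp a ≤ Real.exp M := Real.exp_le_exp.2 ha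
    have h4 := Real.exp_pos a
    calc Real.exp a - Real.exp b = Real.exp a * (1 - Real.exp (b - a)) := by rw [h2]; ring
      _ ≤ Real.exp a * (a - b) := mul_le_mul_of_nonneg_left (by linarith) h4.le
      _ ≤ Real.exp M * (a - b) := mul_le_mul_of_nonneg_right h3 (by linarith)
  rcases le_total b a with h | h
  · rw [abs_of_nonneg (sub_nonneg.2 (Real.exp_le_exp.2 h)), abs_of_nonneg (sub_nonneg.2 h)]
    exact key a b ha h
  · rw [abs_sub_comm, abs_sub_comm a,
      abs_of_nonneg (sub_nonneg.2 (Real.exp_le_exp.2 h)), abs_of_nonneg (sub_nonneg.2 h)]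
    exact key b a hb h

/-- The hard half of the Donsker–Varadhan variational formula, with bounded continuous
test functions. -/
theorem exists_continuous_lt_of_lt_klDiv {μ ν : Measure ℝ} [IsProbabilityMeasure μ]
    [IsProbabilityMeasure ν] {c : ℝ} (h : ENNReal.ofReal c < klDiv μ ν) :
    ∃ (g : ℝ → ℝ) (M : ℝ), Continuous g ∧ (∀ x, |g x| ≤ M) ∧
      c < ∫ x, g x ∂μ - ∫ x, Real.exp (g x) ∂ν + 1 := by
  obtain ⟨g, M, hgm, hgM, hg⟩ := exists_measurable_lt_of_lt_klDiv h
  have hM0 : 0 ≤ M := (abs_nonneg _).trans (hgM 0)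
  have hgi : ∀ ρ : Measure ℝ, IsFiniteMeasure ρ → Integrable g ρ := fun ρ _ =>
    Integrable.of_bound hgm.aestronglyMeasurable M (ae_of_all _ hgM)
  set gap := ∫ x, g x ∂μ - ∫ x, Real.exp (g x) ∂ν + 1 - c
  have hgap : 0 < gap := sub_pos.2 hg
  set δ := gap / (2 * (1 + Real.exp M))
  have hδ : 0 < δ := by positivity
  -- Approximation in `L¹(μ + ν)` controls both integrals at once. Clamping `φ` to the range of `g`
  -- keeps the error and makes `exp` Lipschitz with constant `exp M`, whence the factor `1 + exp M`
  -- in `δ`.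
  obtain ⟨φ, hφ, hφi⟩ := (hgi (μ + ν) inferInstance).exists_boundedContinuous_integral_sub_le hδ
  set ψ : ℝ → ℝ := fun x => max (-M) (min M (φ x)) with hψ
  have hψc : Continuous ψ := continuous_const.max (continuous_const.min φ.continuous)
  have hψM : ∀ x, |ψ x| ≤ M := fun x =>
    abs_le.2 ⟨le_max_left _ _, max_le (by linarith) (min_le_left _ _)⟩
  have hψi : ∀ ρ : Measure ℝ, IsFiniteMeasure ρ → Integrable ψ ρ := fun ρ _ =>
    Integrable.of_bound hψc.aestronglyMeasurable M (ae_of_all _ hψM)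
  have hdiff : ∀ x, |g x - ψ x| ≤ ‖g x - φ x‖ := fun x => by
    have hgx := abs_le.1 (hgM x)
    have : g x = max (-M) (min M (g x)) := by rw [min_eq_right hgx.2, max_eq_right hgx.1]
    rw [Real.norm_eq_abs]
    conv_lhs => rw [this]
    simp only [hψ, max_comm (-M), min_comm M]
    exact (abs_max_sub_max_le_abs _ _ _).trans (abs_inf_sub_inf_le_abs _ _ _)
  have hdi : ∀ ρ : Measure ℝ, IsFiniteMeasure ρ → Integrable (fun x => |g x - ψ x|) ρ :=
    fun ρ hρ => ((hgi ρ hρ).sub (hψi ρ hρ)).abs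
  have hsum : ∫ x, |g x - ψ x| ∂μ + ∫ x, |g x - ψ x| ∂ν ≤ δ := by
    rw [← integral_add_measure (hdi μ inferInstance) (hdi ν inferInstance)]
    refine (integral_mono (hdi _ inferInstance) ?_ hdiff).trans hφ
    exact ((hgi (μ + ν) inferInstance).sub hφi).norm
  have hμ0 : 0 ≤ ∫ x, |g x - ψ x| ∂μ := integral_nonneg fun x => abs_nonneg _
  have hν0 : 0 ≤ ∫ x, |g x - ψ x| ∂ν := integral_nonneg fun x => abs_nonneg _
  have h1 : ∫ x, g x ∂μ - ∫ x, ψ x ∂μ ≤ δ := by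
    rw [← integral_sub (hgi μ inferInstance) (hψi μ inferInstance)]
    exact (le_abs_self _).trans (abs_integral_le_integral_abs.trans (by linarith))
  have hexpi : ∀ u : ℝ → ℝ, Measurable u → (∀ x, |u x| ≤ M) →
      Integrable (fun x => Real.exp (u x)) ν := fun u hu huM =>
    Integrable.of_bound hu.exp.aestronglyMeasurable (Real.exp M) (ae_of_all _ fun x => by
      rw [Real.norm_of_nonneg (Real.exp_pos _).le]
      exact Real.exp_le_exp.2 (abs_le.1 (huM x)).2)
  have h2 : ∫ x, Real.exp (ψ x) ∂ν - ∫ x, Real.exp (g x) ∂ν ≤ Real.exp M * δ := by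
    rw [← integral_sub (hexpi ψ hψc.measurable hψM) (hexpi g hgm hgM)]
    refine (le_abs_self _).trans (abs_integral_le_integral_abs.trans ?_)
    calc ∫ x, |Real.exp (ψ x) - Real.exp (g x)| ∂ν
        ≤ ∫ x, Real.exp M * |g x - ψ x| ∂ν := by
          refine integral_mono ((hexpi ψ hψc.measurable hψM).sub (hexpi g hgm hgM)).abs
            ((hdi ν inferInstance).const_mul _) fun x => ?_
          rw [abs_sub_comm (g x)]
          exact abs_exp_sub_exp_le (abs_le.1 (hψM x)).2 (abs_le.1 (hgM x)).2
      _ = Real.exp M * ∫ x, |g x - ψ x| ∂ν := integral_const_mul _ _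
      _ ≤ Real.exp M * δ := by
          have := Real.exp_pos M
          gcongr
          linarith
  refine ⟨ψ, M, hψc, hψM, ?_⟩
  have h3 : δ * (1 + Real.exp M) = gap / 2 := by
    simp only [δ]
    field_simp
  have h4 : ∫ x, g x ∂μ - ∫ x, Real.exp (g x) ∂ν + 1 - c = gap := rfl
  linarith

/-! ### Test functions for the rate. -/

theorem rate_of_mem {R α : ℝ} {μ : ProbabilityMeasure ℝ} (hμ : μ ∈ momentBall V R) :
    rate V R α μ = klDiv (μ : Measure ℝ) (gibbs V α) +
      ENNReal.ofReal (α * ((moment V μ).toReal - R)) := if_pos hμ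

theorem rate_of_notMem {R α : ℝ} {μ : ProbabilityMeasure ℝ} (hμ : μ ∉ momentBall V R) :
    rate V R α μ = ∞ := if_neg hμ

/-- This is the envelope of the truncated test functions: negligible against the linear growth of
`V`, yet large enough for `exp` of its negative to be integrable. -/
theorem IsOrlicz.isLittleO_const_add_log (hV : IsOrlicz V) (C : ℝ) :
    (fun x : ℝ => C + 2 * Real.log (1 + |x|)) =o[Bornology.cobounded ℝ] V := by
  have h1 : Tendsto (fun x : ℝ => 1 + |x|) (Bornology.cobounded ℝ) atTop :=
    tendsto_atTop_add_const_left _ _ (tendsto_norm_cobounded_atTop (E := ℝ))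
  have h2 : (fun y : ℝ => C + 2 * Real.log y) =o[atTop] fun y : ℝ => y :=
    (Asymptotics.isLittleO_const_id_atTop C).add
      (Real.isLittleO_log_id_atTop.const_mul_left 2)
  refine (h2.comp_tendsto h1).trans_isBigO ?_
  have hV1 := hV.pos 1 one_ne_zero
  refine Asymptotics.IsBigO.of_bound (2 / V 1) ?_
  filter_upwards [(tendsto_norm_cobounded_atTop (E := ℝ)).eventually_ge_atTop 3] with x hx
  rw [Real.norm_eq_abs] at hx
  have h := hV.linear_le x
  simp only [Function.comp_apply]
  rw [Real.norm_of_nonneg (by positivity), Real.norm_of_nonneg (hV.nonneg x), div_mul_eq_mul_div,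
    le_div_iff₀ hV1]
  nlinarith

theorem integrable_exp_neg_two_mul_log : Integrable fun x : ℝ =>
    Real.exp (-(2 * Real.log (1 + |x|))) := by
  have := integrable_one_add_norm (E := ℝ) (μ := volume) (r := 2) (by simp)
  refine this.congr (ae_of_all _ fun x => ?_)
  simp only
  rw [Real.rpow_def_of_pos (by positivity), Real.norm_eq_abs]
  ring_nf

/-- A test function of slower growth than `V` that witnesses a lower bound for the rate. -/
theorem IsOrlicz.exists_test_function (hV : IsOrlicz V) {R α : ℝ} (hα : α < 0)
    (hR : 0 < R) {μ : ProbabilityMeasure ℝ} (hμ : μ ∈ momentBall V R) {c : ℝ}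
    (hc : ENNReal.ofReal c < rate V R α μ) :
    ∃ f : ℝ → ℝ, Continuous f ∧ f =o[Bornology.cobounded ℝ] V ∧
      Integrable (fun x => Real.exp (f x)) ∧ 0 < ∫ x, Real.exp (f x) ∧
      c < ∫ x, f x ∂(μ : Measure ℝ) - Real.log (∫ x, Real.exp (f x)) +
        Real.log (partition V α) - α * R := by
  have hZ := hV.partition_pos hα
  have := hV.isProbabilityMeasure_gibbs hα
  have hVi := hV.integrable_of_mem_momentBall hμ
  set m := ∫ x, V x ∂(μ : Measure ℝ) with hm
  -- the Donsker–Varadhan test function for the Gibbs measure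
  obtain ⟨g, M, hgc, hgM, hg⟩ : ∃ (g : ℝ → ℝ) (M : ℝ), Continuous g ∧ (∀ x, |g x| ≤ M) ∧
      c - α * (m - R) < ∫ x, g x ∂(μ : Measure ℝ) - ∫ x, Real.exp (g x) ∂(gibbs V α) + 1 := by
    -- If the moment term alone exceeds `c`, then `g = 0` suffices; otherwise `c - α (m - R)` is
    -- nonnegative and `ENNReal.ofReal` loses nothing.
    rcases lt_or_ge c (α * (m - R)) with hlt | hge
    · exact ⟨fun _ => 0, 0, continuous_const, by simp, by simp; linarith⟩
    · refine exists_continuous_lt_of_lt_klDiv ?_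
      rw [rate_of_mem hμ, ← hV.integral_eq_toReal_moment] at hc
      have ha : 0 ≤ α * (m - R) := mul_nonneg_of_nonpos_of_nonpos hα.le
        (sub_nonpos.2 (hV.integral_le_of_mem_momentBall hR hμ))
      have hsplit : ENNReal.ofReal c =
          ENNReal.ofReal (c - α * (m - R)) + ENNReal.ofReal (α * (m - R)) := by
        rw [← ENNReal.ofReal_add (by linarith) ha]
        ring_nf
      rw [hsplit] at hc
      exact lt_of_add_lt_add_right hc
  have hM0 : 0 ≤ M := (abs_nonneg _).trans (hgM 0)
  set ℓ : ℝ → ℝ := fun x => 2 * Real.log (1 + |x|) with hℓ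
  have hℓ0 : ∀ x, 0 ≤ ℓ x := fun x =>
    mul_nonneg zero_le_two (Real.log_nonneg (by linarith [abs_nonneg x]))
  have hℓc : Continuous ℓ := continuous_const.mul
    ((continuous_const.add continuous_abs).log fun x => (by positivity : 1 + |x| ≠ 0))
  -- Flooring `α V` at `-T - ℓ` makes it `o(V)`. The logarithmic `ℓ` is needed because a constant
  -- floor would destroy the integrability of `exp φ` under Lebesgue measure.
  set φ : ℕ → ℝ → ℝ := fun T x => max (α * V x) (-T - ℓ x) with hφ
  have hφc : ∀ T, Continuous (φ T) := fun T =>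
    (hV.continuous.const_mul α).max (continuous_const.sub hℓc)
  have hφ0 : ∀ T x, φ T x ≤ 0 := fun T x => max_le
    (mul_nonpos_of_nonpos_of_nonneg hα.le (hV.nonneg x))
    (by linarith [hℓ0 x, T.cast_nonneg (α := ℝ)])
  have hφlim : ∀ x, Tendsto (fun T => φ T x) atTop (𝓝 (α * V x)) := fun x => by
    refine tendsto_const_nhds.congr' ?_
    obtain ⟨N, hN⟩ := exists_nat_ge (-(α * V x))
    filter_upwards [eventually_ge_atTop N] with T hT
    have : (N : ℝ) ≤ T := Nat.cast_le.2 hT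
    exact (max_eq_left (by linarith [hℓ0 x])).symm
  have hgi : Integrable g (μ : Measure ℝ) :=
    Integrable.of_bound hgc.aestronglyMeasurable M (ae_of_all _ hgM)
  have hfc : ∀ T, Continuous fun x => g x + φ T x := fun T => hgc.add (hφc T)
  -- convergence of the integrals against `μ`
  have hlim1 : Tendsto (fun T : ℕ => ∫ x, (g x + φ T x) ∂(μ : Measure ℝ)) atTop
      (𝓝 (∫ x, (g x + α * V x) ∂(μ : Measure ℝ))) := by
    refine tendsto_integral_of_dominated_convergence (fun x => M + -α * V x)
      (fun T => (hfc T).aestronglyMeasurable) ((integrable_const M).add (hVi.const_mul _))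
      (fun T => ae_of_all _ fun x => ?_) (ae_of_all _ fun x => (hφlim x).const_add _)
    refine (norm_add_le _ _).trans (add_le_add (hgM x) ?_)
    rw [Real.norm_of_nonpos (hφ0 T x), neg_mul]
    exact neg_le_neg (le_max_left _ _)
  have hval1 : ∫ x, (g x + α * V x) ∂(μ : Measure ℝ) = ∫ x, g x ∂(μ : Measure ℝ) + α * m := by
    rw [integral_add hgi (hVi.const_mul _), integral_const_mul]
  -- convergence of the exponential integrals
  have hdom : ∀ (T : ℕ) x, Real.exp (g x + φ T x) ≤
      Real.exp M * (Real.exp (α * V x) + Real.exp (-ℓ x)) := fun T x => by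
    rw [Real.exp_add]
    refine mul_le_mul (Real.exp_le_exp.2 (abs_le.1 (hgM x)).2) ?_ (Real.exp_pos _).le
      (Real.exp_pos _).le
    rcases le_total (α * V x) (-T - ℓ x) with h | h
    · simp only [hφ, max_eq_right h]
      have h1 : Real.exp (-T - ℓ x) ≤ Real.exp (-ℓ x) :=
        Real.exp_le_exp.2 (by linarith [T.cast_nonneg (α := ℝ)])
      linarith [Real.exp_pos (α * V x)]
    · simp only [hφ, max_eq_left h]
      linarith [Real.exp_pos (-ℓ x)]
  have hdomi : Integrable fun x => Real.exp M * (Real.exp (α * V x) + Real.exp (-ℓ x)) :=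
    ((hV.integrable_exp hα).add integrable_exp_neg_two_mul_log).const_mul _
  have hexpi : ∀ T : ℕ, Integrable fun x => Real.exp (g x + φ T x) := fun T =>
    hdomi.mono' (hfc T).rexp.aestronglyMeasurable (ae_of_all _ fun x => by
      rw [Real.norm_of_nonneg (Real.exp_pos _).le]
      exact hdom T x)
  have hlim2 : Tendsto (fun T : ℕ => ∫ x, Real.exp (g x + φ T x)) atTop
      (𝓝 (∫ x, Real.exp (g x + α * V x))) := by
    refine tendsto_integral_of_dominated_convergence _
      (fun T => (hfc T).rexp.aestronglyMeasurable) hdomi (fun T => ae_of_all _ fun x => ?_)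
      (ae_of_all _ fun x => ((Real.continuous_exp.tendsto _).comp ((hφlim x).const_add _)))
    rw [Real.norm_of_nonneg (Real.exp_pos _).le]
    exact hdom T x
  have hval2 : ∫ x, Real.exp (g x + α * V x) =
      partition V α * ∫ x, Real.exp (g x) ∂(gibbs V α) := by
    rw [gibbs_eq, integral_withDensity_eq_integral_toReal_smul
      (((hV.continuous.const_mul α).rexp.div_const _).measurable.ennreal_ofReal)
      (ae_of_all _ fun x => ENNReal.ofReal_lt_top), ← integral_const_mul]
    refine integral_congr_ae (ae_of_all _ fun x => ?_)
    simp only [smul_eq_mul]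
    rw [ENNReal.toReal_ofReal (div_nonneg (Real.exp_pos _).le hZ.le), Real.exp_add]
    field_simp
  have hE : 0 < ∫ x, Real.exp (g x) ∂(gibbs V α) := integral_exp_pos
    (Integrable.of_bound hgc.rexp.aestronglyMeasurable (Real.exp M) (ae_of_all _ fun x => by
      rw [Real.norm_of_nonneg (Real.exp_pos _).le]
      exact Real.exp_le_exp.2 (abs_le.1 (hgM x)).2))
  have hlim3 := (hlim1.sub ((Real.continuousAt_log
    (by rw [hval2]; positivity)).tendsto.comp hlim2)).add_const (Real.log (partition V α) - α * R)
  have hlt : c < ∫ x, (g x + α * V x) ∂(μ : Measure ℝ) -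
      Real.log (∫ x, Real.exp (g x + α * V x)) + (Real.log (partition V α) - α * R) := by
    rw [hval1, hval2, Real.log_mul hZ.ne' hE.ne']
    -- The inequality `log E ≤ E - 1` passes from the linearized variational formula to the
    -- logarithmic one.
    have := Real.log_le_sub_one_of_pos hE
    linarith
  obtain ⟨T, hT⟩ := (hlim3.eventually (lt_mem_nhds hlt)).exists
  refine ⟨fun x => g x + φ T x, hfc T, ?_, hexpi T, integral_exp_pos (hexpi T), ?_⟩
  · refine Asymptotics.IsBigO.trans_isLittleO (Asymptotics.IsBigO.of_bound 1
      (Eventually.of_forall fun x => ?_)) (hV.isLittleO_const_add_log (M + T))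
    have hT0 := T.cast_nonneg (α := ℝ)
    have h0 := hℓ0 x
    simp only [hℓ] at h0
    rw [one_mul, Real.norm_of_nonneg (show 0 ≤ M + T + 2 * Real.log (1 + |x|) by linarith),
      add_assoc]
    refine (norm_add_le _ _).trans (add_le_add (hgM x) ?_)
    rw [Real.norm_of_nonpos (hφ0 T x)]
    have : -(T : ℝ) - ℓ x ≤ φ T x := le_max_right _ _
    simp only [hℓ] at this
    linarith
  · simp only [Function.comp_apply] at hT
    linarith

/-! ### Product integrals and the exponential Chebyshev inequality. -/

theorem lintegral_pi_prod (n : ℕ) {f : Fin n → ℝ → ℝ≥0∞} (hf : ∀ i, Measurable (f i)) :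
    ∫⁻ x : Fin n → ℝ, ∏ i, f i (x i) = ∏ i, ∫⁻ x, f i x := by
  induction n with
  | zero => simp [lintegral_unique, volume_pi]
  | succ n ih =>
    have hm : Measurable fun x : Fin n → ℝ => ∏ i : Fin n, f i.succ (x i) :=
      Finset.measurable_fun_prod _ fun i _ => (hf _).comp (measurable_pi_apply i)
    have hmp := (volume_preserving_piFinSuccAbove (fun _ : Fin (n + 1) => ℝ) 0).symm
    rw [← hmp.lintegral_comp_emb (MeasurableEquiv.measurableEmbedding _), Fin.prod_univ_succ,
      ← ih fun i => hf i.succ, Measure.volume_eq_prod,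
      ← lintegral_prod_mul (hf 0).aemeasurable hm.aemeasurable]
    simp [Fin.prod_univ_succ]

/-- An exponential Chebyshev inequality for Lebesgue measure. -/
theorem volume_le_of_exp {f : ℝ → ℝ} (hf : Continuous f)
    (hi : Integrable fun x => Real.exp (f x)) (s : ℝ) (n : ℕ) :
    volume {x : Fin n → ℝ | s * n ≤ ∑ i, f (x i)} ≤
      ENNReal.ofReal (Real.exp (-(n * s)) * (∫ x, Real.exp (f x)) ^ n) := by
  have hm : Measurable fun x => ENNReal.ofReal (Real.exp (f x)) :=
    hf.rexp.measurable.ennreal_ofReal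
  have hmp : Measurable fun x : Fin n → ℝ => ∏ i, ENNReal.ofReal (Real.exp (f (x i))) :=
    Finset.measurable_fun_prod _ fun i _ => hm.comp (measurable_pi_apply i)
  refine (measure_mono fun x hx => ?_).trans ((meas_ge_le_lintegral_div hmp.aemeasurable
    (ε := ENNReal.ofReal (Real.exp (n * s))) (by simp [Real.exp_pos])
    ENNReal.ofReal_ne_top).trans (le_of_eq ?_))
  · rw [Set.mem_ofPred_eq, ← ENNReal.ofReal_prod_of_nonneg fun i _ => (Real.exp_pos _).le,
      ← Real.exp_sum]
    have : s * n ≤ ∑ i, f (x i) := hx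
    exact ENNReal.ofReal_le_ofReal (Real.exp_le_exp.2 (by linarith))
  · rw [lintegral_pi_prod n fun _ => hm, Finset.prod_const, Finset.card_univ,
      Fintype.card_fin, ← ofReal_integral_eq_lintegral_ofReal hi (ae_of_all _ fun x => (Real.exp_pos _).le), ← ENNReal.ofReal_pow
      (integral_nonneg fun x => (Real.exp_pos _).le), ← ENNReal.ofReal_div_of_pos (Real.exp_pos _),
      Real.exp_neg, div_eq_inv_mul]

/-! ### Laws of large numbers in probability. -/

/-- The filter of events whose probability tends to one. -/
def highProbability (Q : ∀ n : ℕ+, Measure (Fin n → ℝ)) : Filter (Σ n : ℕ+, Fin n → ℝ) where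
  sets := {S | Tendsto (fun n => Q n {x | (⟨n, x⟩ : Σ n : ℕ+, Fin n → ℝ) ∉ S}) atTop (𝓝 0)}
  univ_sets := by simp
  sets_of_superset {S T} hS hST :=
    tendsto_of_tendsto_of_tendsto_of_le_of_le tendsto_const_nhds hS (fun _ => zero_le)
      fun n => measure_mono fun x hx h => hx (hST h)
  inter_sets {S T} hS hT := by
    have := Tendsto.add hS hT
    rw [add_zero] at this
    refine tendsto_of_tendsto_of_tendsto_of_le_of_le tendsto_const_nhds this (fun _ => zero_le)
      fun n => (measure_mono fun x hx => ?_).trans (measure_union_le _ _)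
    by_contra hcon
    simp only [Set.mem_union, not_or, Set.mem_ofPred_eq, not_not] at hcon
    exact hx hcon

theorem mem_highProbability {Q : ∀ n : ℕ+, Measure (Fin n → ℝ)} {S : Set (Σ n : ℕ+, Fin n → ℝ)} :
    S ∈ highProbability Q ↔
      Tendsto (fun n => Q n {x | (⟨n, x⟩ : Σ n : ℕ+, Fin n → ℝ) ∉ S}) atTop (𝓝 0) := Iff.rfl

/-- The weak law of large numbers for the coordinates of a product measure. -/
theorem tendsto_average (μ : Measure ℝ) [IsProbabilityMeasure μ] {f : ℝ → ℝ} (hf : Measurable f)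
    (hfi : Integrable f μ) :
    Tendsto (fun p : Σ n : ℕ+, Fin n → ℝ => ((p.1 : ℕ) : ℝ)⁻¹ * ∑ i, f (p.2 i))
      (highProbability fun n => Measure.pi fun _ : Fin n => μ) (𝓝 (∫ x, f x ∂μ)) := by
  -- All sample sizes are realized on one infinite product, where the strong law holds; convergence
  -- in measure then descends to the finite marginals.
  set Λ := Measure.infinitePi fun _ : ℕ => μ
  set Y : ℕ → (ℕ → ℝ) → ℝ := fun i ω => f (ω i) with hY
  have hmap : ∀ i : ℕ, Λ.map (fun ω => ω i) = μ := fun i => Measure.infinitePi_map_eval _ i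
  have hYm : ∀ i, Measurable (Y i) := fun i => hf.comp (measurable_pi_apply i)
  have hYi : ∀ i, Integrable (Y i) Λ := fun i => by
    have h : Integrable f (Λ.map fun ω => ω i) := by rwa [hmap i]
    exact h.comp_measurable (measurable_pi_apply i)
  have hY0 : ∫ ω, Y 0 ω ∂Λ = ∫ x, f x ∂μ := by
    conv_rhs => rw [← hmap 0]
    exact (integral_map (measurable_pi_apply 0).aemeasurable hf.aestronglyMeasurable).symm
  have hind : iIndepFun Y Λ := iIndepFun_infinitePi (X := fun _ => f) fun _ => hf
  have hident : ∀ i, IdentDistrib (Y i) (Y 0) Λ Λ := fun i =>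
    (⟨(measurable_pi_apply i).aemeasurable, (measurable_pi_apply 0).aemeasurable,
      (hmap i).trans (hmap 0).symm⟩ : IdentDistrib (fun ω : ℕ → ℝ => ω i) (fun ω => ω 0) Λ Λ).comp hf
  have hlln := strong_law_ae_real Y (hYi 0) (fun i j hij => hind.indepFun hij) hident
  have hmeas := tendstoInMeasure_of_tendsto_ae (fun n : ℕ =>
    ((Finset.measurable_fun_sum (Finset.range n) fun i _ => hYm i).div_const
      (n : ℝ)).aestronglyMeasurable) hlln
  refine Metric.tendsto_nhds.2 fun ε hε => ?_
  rw [Filter.Eventually, mem_highProbability]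
  refine ((hmeas (ENNReal.ofReal ε) (by simpa using hε)).comp
    tendsto_PNat_val_atTop_atTop).congr fun n => ?_
  have hpi : Λ.map (fun ω (i : Fin n) => ω i) = Measure.pi fun _ : Fin n => μ := by
    rw [Measure.map_infinitePi_infinitePi_of_inj (f := fun i : Fin n => (i : ℕ)) Fin.val_injective,
      Measure.infinitePi_eq_pi]
  have hset : MeasurableSet {x : Fin n → ℝ |
      (⟨n, x⟩ : Σ n : ℕ+, Fin n → ℝ) ∉ {p : Σ n : ℕ+, Fin n → ℝ |
        dist (((p.1 : ℕ) : ℝ)⁻¹ * ∑ i, f (p.2 i)) (∫ x, f x ∂μ) < ε}} := by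
    have : Measurable fun x : Fin n → ℝ =>
        dist (((n : ℕ) : ℝ)⁻¹ * ∑ i, f (x i)) (∫ x, f x ∂μ) :=
      ((Finset.measurable_fun_sum _ fun i _ =>
        hf.comp (measurable_pi_apply i)).const_mul _).dist measurable_const
    exact (measurableSet_lt this measurable_const).compl
  rw [← hpi, Measure.map_apply (measurable_pi_lambda _ fun i => measurable_pi_apply _) hset]
  simp only [Function.comp_apply]
  congr 1
  ext ω
  rw [hY0]
  simp only [Set.mem_ofPred_eq, Set.mem_preimage, not_lt, hY]
  rw [edist_dist, ENNReal.ofReal_le_ofReal_iff dist_nonneg, Finset.sum_range, div_eq_inv_mul]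

/-- The empirical measures of an i.i.d. sample converge weakly in probability. -/
theorem tendsto_empirical (μ : ProbabilityMeasure ℝ) {T : ℝ → ℝ} (hT : Continuous T) :
    Tendsto (fun p : Σ n : ℕ+, Fin n → ℝ => empirical p.1 fun i => T (p.2 i))
      (highProbability fun n => Measure.pi fun _ : Fin n => (μ : Measure ℝ))
      (𝓝 (μ.map hT.aemeasurable)) := by
  refine ProbabilityMeasure.tendsto_iff_forall_integral_tendsto.2 fun f => ?_
  simp_rw [integral_empirical]
  rw [ProbabilityMeasure.toMeasure_map, integral_map hT.aemeasurable
    f.continuous.aestronglyMeasurable]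
  exact tendsto_average (μ : Measure ℝ) (f := fun x => f (T x)) (f.continuous.comp hT).measurable
    (Integrable.of_bound (f.continuous.comp hT).aestronglyMeasurable ‖f‖
      (ae_of_all _ fun x => f.norm_coe_le_norm _))

/-! ### Volume lower bounds by change of measure. -/

theorem pi_withDensity {p : ℝ → ℝ≥0∞} (hp : Measurable p)
    [IsProbabilityMeasure (volume.withDensity p)] (n : ℕ) :
    Measure.pi (fun _ : Fin n => volume.withDensity p) =
      (volume : Measure (Fin n → ℝ)).withDensity fun x => ∏ i, p (x i) := by
  refine Measure.pi_eq fun s hs => ?_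
  rw [withDensity_apply _ (MeasurableSet.univ_pi hs),
    ← lintegral_indicator (MeasurableSet.univ_pi hs)]
  simp_rw [withDensity_apply _ (hs _), ← lintegral_indicator (hs _)]
  rw [← lintegral_pi_prod n fun i => hp.indicator (hs i)]
  refine lintegral_congr fun x => ?_
  by_cases hx : x ∈ Set.univ.pi s
  · rw [Set.indicator_of_mem hx]
    exact Finset.prod_congr rfl fun i _ => (Set.indicator_of_mem (hx i (Set.mem_univ i)) _).symm
  · rw [Set.indicator_of_notMem hx]
    obtain ⟨i, hi⟩ : ∃ i, x i ∉ s i := by simpa using hx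
    exact (Finset.prod_eq_zero (Finset.mem_univ i) (Set.indicator_of_notMem hi _)).symm

/-- The Lebesgue volume of a set on which the log-density of a product measure is controlled. -/
theorem IsOrlicz.pi_le_volume (hV : IsOrlicz V) {α : ℝ} (hα : α < 0) {μ : Measure ℝ}
    [IsProbabilityMeasure μ] (hμ : μ ≪ gibbs V α) (n : ℕ) {E : Set (Fin n → ℝ)}
    (hE : MeasurableSet E) {s : ℝ}
    (hs : ∀ x ∈ E, ∑ i, (llr μ (gibbs V α) (x i) + α * V (x i) - Real.log (partition V α)) ≤ s) :
    Measure.pi (fun _ : Fin n => μ) E ≤ ENNReal.ofReal (Real.exp s) * volume E := by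
  have := hV.isProbabilityMeasure_gibbs hα
  have hZ := hV.partition_pos hα
  set r : ℝ → ℝ≥0∞ := fun x => ENNReal.ofReal (μ.rnDeriv (gibbs V α) x).toReal
  set d : ℝ → ℝ≥0∞ := fun x => ENNReal.ofReal (Real.exp (α * V x) / partition V α)
  have hr : Measurable r := (Measure.measurable_rnDeriv _ _).ennreal_toReal.ennreal_ofReal
  have hd : Measurable d :=
    ((hV.continuous.const_mul α).rexp.div_const _).measurable.ennreal_ofReal
  have hμd : μ = volume.withDensity (d * r) := by
    rw [withDensity_mul _ hd hr]
    conv_lhs => rw [← Measure.withDensity_rnDeriv_eq _ _ hμ]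
    refine withDensity_congr_ae ?_
    filter_upwards [Measure.rnDeriv_lt_top μ (gibbs V α)] with x hx
    exact (ENNReal.ofReal_toReal hx.ne).symm
  have hprob : IsProbabilityMeasure (volume.withDensity (d * r)) := by
    rw [← hμd]
    infer_instance
  -- Only an inequality: where the density of `μ` vanishes, `Real.log 0 = 0` makes the right-hand
  -- side positive.
  have hle : ∀ x, (d * r) x ≤ ENNReal.ofReal
      (Real.exp (llr μ (gibbs V α) x + α * V x - Real.log (partition V α))) := fun x => by
    simp only [Pi.mul_apply, d, r]
    rw [← ENNReal.ofReal_mul (div_nonneg (Real.exp_pos _).le hZ.le)]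
    refine ENNReal.ofReal_le_ofReal ?_
    rw [Real.exp_sub, Real.exp_add, Real.exp_log hZ, llr, mul_comm, mul_div_assoc]
    exact mul_le_mul_of_nonneg_right (Real.le_exp_log _)
      (div_nonneg (Real.exp_pos _).le hZ.le)
  have hpi : Measure.pi (fun _ : Fin n => μ) =
      Measure.pi fun _ : Fin n => volume.withDensity (d * r) := by rw [← hμd]
  rw [hpi, pi_withDensity (hd.mul hr), withDensity_apply _ hE, ← setLIntegral_const]
  refine setLIntegral_mono measurable_const fun x hx => ?_
  refine (Finset.prod_le_prod' fun i _ => hle (x i)).trans ?_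
  rw [← ENNReal.ofReal_prod_of_nonneg fun i _ => (Real.exp_pos _).le, ← Real.exp_sum]
  exact ENNReal.ofReal_le_ofReal (Real.exp_le_exp.2 (hs x hx))

/-- This allows the sample to be contracted by a factor `s < 1` close to `1` without leaving a given
neighbourhood of `μ`. -/
theorem tendsto_map_mul (μ : ProbabilityMeasure ℝ) :
    Tendsto (fun s : ℝ => μ.map (continuous_const_mul s).aemeasurable) (𝓝 1) (𝓝 μ) := by
  refine ProbabilityMeasure.tendsto_iff_forall_integral_tendsto.2 fun f => ?_
  have hval : ∀ s : ℝ, ∫ x, f x ∂(μ.map (continuous_const_mul s).aemeasurable : Measure ℝ) =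
      ∫ x, f (s * x) ∂(μ : Measure ℝ) := fun s => by
    rw [ProbabilityMeasure.toMeasure_map, integral_map (continuous_const_mul s).aemeasurable
      f.continuous.aestronglyMeasurable]
  simp_rw [hval]
  refine tendsto_integral_filter_of_dominated_convergence (fun _ => ‖f‖)
    (Eventually.of_forall fun s =>
      (f.continuous.comp (continuous_const_mul s)).aestronglyMeasurable)
    (Eventually.of_forall fun s => ae_of_all _ fun x => f.norm_coe_le_norm _)
    (integrable_const _) (ae_of_all _ fun x => ?_)
  have : Tendsto (fun s : ℝ => f (s * x)) (𝓝 1) (𝓝 (f (1 * x))) :=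
    (f.continuous.comp (continuous_mul_const x)).tendsto 1
  rwa [one_mul] at this

/-- The entropy lower bound for the volume of the part of the Orlicz ball with empirical
measure close to `μ`. -/
theorem IsOrlicz.eventually_le_volume (hV : IsOrlicz V) {R α : ℝ} (hα : α < 0) (hR : 0 < R)
    {μ : ProbabilityMeasure ℝ} (hμ : μ ∈ momentBall V R)
    (hfin : klDiv (μ : Measure ℝ) (gibbs V α) ≠ ∞) {U : Set (ProbabilityMeasure ℝ)}
    (hU : IsOpen U) (hμU : μ ∈ U) {δ : ℝ} (hδ : 0 < δ) :
    ∀ᶠ n : ℕ+ in atTop, ENNReal.ofReal (Real.exp ((n : ℕ) * (Real.log (partition V α) -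
      α * ∫ x, V x ∂(μ : Measure ℝ) - (klDiv (μ : Measure ℝ) (gibbs V α)).toReal - δ))) ≤
      volume (orliczBall V R n ∩ {x | empirical n x ∈ U}) := by
  have := hV.isProbabilityMeasure_gibbs hα
  obtain ⟨hac, hllr⟩ := klDiv_ne_top_iff.1 hfin
  have hVi := hV.integrable_of_mem_momentBall hμ
  have hmR := hV.integral_le_of_mem_momentBall hR hμ
  rw [toReal_klDiv_of_measure_eq hac (by simp)]
  set m := ∫ x, V x ∂(μ : Measure ℝ)
  set H := ∫ x, llr (μ : Measure ℝ) (gibbs V α) x ∂(μ : Measure ℝ)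
  set q : ℝ → ℝ := fun x =>
    llr (μ : Measure ℝ) (gibbs V α) x + α * V x - Real.log (partition V α) with hq
  have hqm : Measurable q := ((measurable_llr _ _).add (hV.measurable.const_mul α)).sub_const _
  have hqi : Integrable q (μ : Measure ℝ) :=
    (hllr.add (hVi.const_mul α)).sub (integrable_const _)
  have hqint : ∫ x, q x ∂(μ : Measure ℝ) = H + α * m - Real.log (partition V α) := by
    have h1 : ∫ x, q x ∂(μ : Measure ℝ) = ∫ x, (llr (μ : Measure ℝ) (gibbs V α) x + α * V x)
        ∂(μ : Measure ℝ) - ∫ _x, Real.log (partition V α) ∂(μ : Measure ℝ) :=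
      integral_sub (hllr.add (hVi.const_mul α)) (integrable_const _)
    rw [h1, integral_add hllr (hVi.const_mul α), integral_const_mul]
    simp [H, m]
  -- a contraction factor close to one
  obtain ⟨s, hs1, hs0, hsU, hslog⟩ : ∃ s : ℝ, s < 1 ∧ 0 < s ∧
      μ.map (continuous_const_mul s).aemeasurable ∈ U ∧ -(δ / 4) < Real.log s := by
    have h1 : ∀ᶠ s in 𝓝[<] (1 : ℝ), μ.map (continuous_const_mul s).aemeasurable ∈ U :=
      ((tendsto_map_mul μ).eventually (hU.mem_nhds hμU)).filter_mono nhdsWithin_le_nhds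
    have h2 : ∀ᶠ s in 𝓝[<] (1 : ℝ), -(δ / 4) < Real.log s := by
      refine Eventually.filter_mono nhdsWithin_le_nhds
        ((Real.continuousAt_log one_ne_zero).eventually (lt_mem_nhds ?_))
      rw [Real.log_one]
      linarith
    have h3 : ∀ᶠ s in 𝓝[<] (1 : ℝ), 0 < s :=
      Eventually.filter_mono nhdsWithin_le_nhds (lt_mem_nhds one_pos)
    obtain ⟨s, hs⟩ := (eventually_mem_nhdsWithin.and (h3.and (h1.and h2))).exists
    exact ⟨s, hs.1, hs.2.1, hs.2.2.1, hs.2.2.2⟩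
  set Q : ∀ n : ℕ+, Measure (Fin n → ℝ) := fun n => Measure.pi fun _ : Fin n => (μ : Measure ℝ)
  set E : ∀ n : ℕ+, Set (Fin n → ℝ) := fun n =>
    {x | ((n : ℕ) : ℝ)⁻¹ * ∑ i, q (x i) < H + α * m - Real.log (partition V α) + δ / 4 ∧
      ((n : ℕ) : ℝ)⁻¹ * ∑ i, V (x i) < R + (1 - s) * R ∧
      (empirical n fun i => s * x i) ∈ U} with hEdef
  -- Each of the three conditions is a law of large numbers, and the filter intersects them.
  have hE : ∀ᶠ p in highProbability Q, p.2 ∈ E p.1 := by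
    refine ((tendsto_average _ hqm hqi).eventually (gt_mem_nhds ?_)).and
      (((tendsto_average _ hV.measurable hVi).eventually (gt_mem_nhds ?_)).and
      ((tendsto_empirical μ (continuous_const_mul s)).eventually (hU.mem_nhds hsU)))
    · rw [hqint]
      linarith
    · have := mul_pos (sub_pos.2 hs1) hR
      change m < _
      linarith
  have hEm : ∀ n, MeasurableSet (E n) := fun n => by
    have hav : ∀ u : ℝ → ℝ, Measurable u →
        Measurable fun x : Fin n → ℝ => ((n : ℕ) : ℝ)⁻¹ * ∑ i, u (x i) := fun u hu =>
      (Finset.measurable_fun_sum _ fun i _ => hu.comp (measurable_pi_apply i)).const_mul _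
    have hemp : Continuous fun x : Fin n → ℝ => empirical n fun i => s * x i :=
      (continuous_empirical n).comp (by fun_prop)
    exact (measurableSet_lt (hav q hqm) measurable_const).inter
      ((measurableSet_lt (hav V hV.measurable) measurable_const).inter
        (hU.preimage hemp).measurableSet)
  have hhalf : ∀ᶠ n in atTop, Q n (E n)ᶜ < 2⁻¹ :=
    (mem_highProbability.1 hE).eventually (gt_mem_nhds (by simp))
  -- The factor `2` pays for the probability `1/2`: eventually `2 exp (-n δ / 2) ≤ 1`.
  filter_upwards [hhalf, eventually_natCast_mul_exp_le 2 (show (0:ℝ) < δ / 2 by linarith)]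
    with n hn1 hn2
  have hn : (0 : ℝ) < (n : ℕ) := Nat.cast_pos.2 n.pos
  have hQE : 2⁻¹ ≤ Q n (E n) := by
    have h1 := prob_add_prob_compl (μ := Q n) (hEm n)
    by_contra hcon
    have h2 := ENNReal.add_lt_add (not_le.1 hcon) hn1
    rw [h1, ENNReal.inv_two_add_inv_two] at h2
    exact lt_irrefl _ h2
  have hvol := hQE.trans (hV.pi_le_volume hα hac n (hEm n)
    (s := (n : ℕ) * (H + α * m - Real.log (partition V α) + δ / 4)) fun x hx => by
      have := hx.1.le
      rwa [inv_mul_le_iff₀ hn] at this)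
  -- Convexity gives `V (s x) ≤ s V x`, and `s (R + (1 - s) R) = (1 - (1 - s)²) R ≤ R`, so the
  -- contraction outweighs the permitted excess of the moment.
  have hsub : s • E n ⊆ orliczBall V R n ∩ {x | empirical n x ∈ U} := by
    rintro _ ⟨x, hx, rfl⟩
    refine ⟨?_, hx.2.2⟩
    have h1 := hx.2.1.le
    rw [inv_mul_le_iff₀ hn] at h1
    calc ∑ i, V (s * x i) ≤ ∑ i, s * V (x i) :=
          Finset.sum_le_sum fun i _ => hV.smul_le hs0.le hs1.le _
      _ = s * ∑ i, V (x i) := (Finset.mul_sum _ _ _).symm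
      _ ≤ s * ((n : ℕ) * (R + (1 - s) * R)) := by gcongr
      _ = (1 - (1 - s) ^ 2) * (R * (n : ℕ)) := by ring
      _ ≤ R * (n : ℕ) := mul_le_of_le_one_left (by positivity) (by nlinarith)
  refine le_trans ?_ (measure_mono hsub)
  rw [Measure.addHaar_smul, Module.finrank_fin_fun, abs_of_pos (pow_pos hs0 _)]
  -- The loss `δ` splits into `δ/4` for the Jacobian `s ^ n`, `δ/4` for the log-density and `δ/2`
  -- for the probability `1/2`.
  have hexp : Real.exp ((n : ℕ) * (Real.log (partition V α) - α * m - H - δ)) ≤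
      s ^ (n : ℕ) * (Real.exp (-((n : ℕ) * (H + α * m - Real.log (partition V α) + δ / 4))) *
        Real.exp (-((n : ℕ) * (δ / 2)))) := by
    have h1 : Real.exp ((n : ℕ) * -(δ / 4)) ≤ s ^ (n : ℕ) := by
      rw [Real.exp_nat_mul]
      refine pow_le_pow_left₀ (Real.exp_pos _).le ?_ _
      rw [← Real.exp_log hs0]
      exact Real.exp_le_exp.2 hslog.le
    refine le_trans (le_of_eq ?_) (mul_le_mul_of_nonneg_right h1 (by positivity))
    rw [← Real.exp_add, ← Real.exp_add]
    ring_nf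
  refine (ENNReal.ofReal_le_ofReal hexp).trans ?_
  rw [ENNReal.ofReal_mul (pow_pos hs0 _).le]
  refine mul_le_mul_right ?_ _
  rw [ENNReal.ofReal_mul (Real.exp_pos _).le]
  have h2 : ENNReal.ofReal (Real.exp (-((n : ℕ) * (δ / 2)))) ≤ 2⁻¹ := by
    rw [mul_zero, neg_zero, Real.exp_zero, ENNReal.ofReal_one] at hn2
    rw [ENNReal.le_inv_iff_mul_le, mul_comm]
    exact_mod_cast hn2
  calc ENNReal.ofReal (Real.exp (-((n : ℕ) * (H + α * m - Real.log (partition V α) + δ / 4)))) *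
        ENNReal.ofReal (Real.exp (-((n : ℕ) * (δ / 2))))
      ≤ ENNReal.ofReal (Real.exp (-((n : ℕ) * (H + α * m - Real.log (partition V α) + δ / 4)))) *
        (ENNReal.ofReal (Real.exp ((n : ℕ) * (H + α * m - Real.log (partition V α) + δ / 4))) *
          volume (E n)) := by gcongr; exact h2.trans hvol
    _ = volume (E n) := by
        rw [← mul_assoc, ← ENNReal.ofReal_mul (Real.exp_pos _).le, ← Real.exp_add, neg_add_cancel,
          Real.exp_zero, ENNReal.ofReal_one, one_mul]

/-! ### The volume of the Orlicz ball and the local bounds. -/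

/-- The Gibbs measure as a point of the space of probability measures. -/
noncomputable def gibbsPM (hV : IsOrlicz V) {β : ℝ} (hβ : β < 0) : ProbabilityMeasure ℝ :=
  ⟨gibbs V β, hV.isProbabilityMeasure_gibbs hβ⟩

/-- Exponential Chebyshev with `f = α V`: as `α < 0`, the moment constraint is a lower bound on `∑ f
(x i)`. -/
theorem IsOrlicz.volume_orliczBall_le (hV : IsOrlicz V) {R α : ℝ} (hα : α < 0) (n : ℕ) :
    volume (orliczBall V R n) ≤
      ENNReal.ofReal (Real.exp (n * (Real.log (partition V α) - α * R))) := by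
  refine (measure_mono fun x hx => ?_).trans ((volume_le_of_exp (hV.continuous.const_mul α)
    (hV.integrable_exp hα) (α * R) n).trans (le_of_eq ?_))
  · have h : ∑ i, V (x i) ≤ R * n := hx
    rw [Set.mem_ofPred_eq, ← Finset.mul_sum, mul_assoc]
    exact mul_le_mul_of_nonpos_left h hα.le
  · have hZ := hV.partition_pos hα
    change ENNReal.ofReal (_ * partition V α ^ n) = _
    conv_lhs => rw [← Real.exp_log hZ, ← Real.exp_nat_mul, ← Real.exp_add]
    ring_nf

theorem IsOrlicz.volume_orliczBall_ne_zero (hV : IsOrlicz V) {R : ℝ} (hR : 0 < R) (n : ℕ+) :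
    volume (orliczBall V R n) ≠ 0 := by
  have hc : Continuous fun x : Fin n → ℝ => ∑ i, V (x i) :=
    continuous_finsetSum _ fun i _ => hV.continuous.comp (continuous_apply i)
  have ho : IsOpen {x : Fin n → ℝ | ∑ i, V (x i) < R * (n : ℕ)} := isOpen_lt hc continuous_const
  have hn : (0 : ℝ) < (n : ℕ) := Nat.cast_pos.2 n.pos
  refine ((ho.measure_pos volume ⟨0, ?_⟩).trans_le (measure_mono fun x hx => ?_)).ne'
  · simp only [Set.mem_ofPred_eq, Pi.zero_apply, hV.zero, Finset.sum_const_zero]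
    positivity
  · have hx' : ∑ i, V (x i) < R * (n : ℕ) := hx
    exact hx'.le

/-- The entropy bound is applied to the Gibbs measure itself: its relative entropy is `0` and its
moment is `R`, so the exponent matches the upper bound on the volume. -/
theorem IsOrlicz.eventually_le_volume_orliczBall (hV : IsOrlicz V) {R α : ℝ} (hα : α < 0)
    (hR : 0 < R) (hαR : ∫⁻ x, ENNReal.ofReal (V x) ∂(gibbs V α) = ENNReal.ofReal R) {δ : ℝ}
    (hδ : 0 < δ) :
    ∀ᶠ n : ℕ+ in atTop, ENNReal.ofReal (Real.exp ((n : ℕ) * (Real.log (partition V α) -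
      α * R - δ))) ≤ volume (orliczBall V R n) := by
  have := hV.isProbabilityMeasure_gibbs hα
  have hmom : moment V (gibbsPM hV hα) = ENNReal.ofReal R := hαR
  have hkl : klDiv (gibbsPM hV hα : Measure ℝ) (gibbs V α) = 0 := klDiv_self (gibbs V α)
  have h := hV.eventually_le_volume hα hR (μ := gibbsPM hV hα) hmom.le (by simp [hkl])
    isOpen_univ (Set.mem_univ _) hδ
  rw [hkl, hV.integral_eq_toReal_moment, hmom, ENNReal.toReal_ofReal hR.le] at h
  filter_upwards [h] with n hn
  simpa using hn

section Sampling

variable {R : ℝ} {Ω : ℕ+ → Type*} [∀ n, MeasurableSpace (Ω n)] {P : ∀ n, Measure (Ω n)}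
  {X : ∀ n : ℕ+, Ω n → (Fin n → ℝ)}

theorem IsOrlicz.measure_empirical (hV : IsOrlicz V) (hR : 0 < R)
    (hX : ∀ n, pdf.IsUniform (X n) (orliczBall V R n) (P n) volume) (n : ℕ+)
    {U : Set (ProbabilityMeasure ℝ)} (hU : IsOpen U) :
    P n {ω | empirical n (X n ω) ∈ U} =
      volume (orliczBall V R n ∩ {x | empirical n x ∈ U}) / volume (orliczBall V R n) :=
  (hX n).measure_preimage (hV.volume_orliczBall_ne_zero hR n)
    (ne_top_of_le_ne_top ENNReal.ofReal_ne_top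
      (hV.volume_orliczBall_le (show (-1 : ℝ) < 0 by norm_num) n))
    (hU.preimage (continuous_empirical n)).measurableSet

theorem IsOrlicz.measure_empirical_notMem (hV : IsOrlicz V) (hR : 0 < R)
    (hX : ∀ n, pdf.IsUniform (X n) (orliczBall V R n) (P n) volume) (n : ℕ+) :
    P n {ω | empirical n (X n ω) ∉ momentBall V R} = 0 := by
  have h := hV.measure_empirical hR hX n (hV.isClosed_momentBall hR).isOpen_compl
  refine h.trans ?_
  have : orliczBall V R n ∩ {x | empirical n x ∈ (momentBall V R)ᶜ} = ∅ := by
    ext x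
    simp only [Set.mem_inter_iff, Set.mem_ofPred_eq, Set.mem_compl_iff,
      hV.empirical_mem_momentBall_iff hR, Set.mem_empty_iff_false, iff_false]
    tauto
  rw [this, measure_empty, ENNReal.zero_div]

theorem IsOrlicz.local_upper_bound (hV : IsOrlicz V) (hR : 0 < R) {α : ℝ} (hα : α < 0)
    (hαR : ∫⁻ x, ENNReal.ofReal (V x) ∂(gibbs V α) = ENNReal.ofReal R)
    (hX : ∀ n, pdf.IsUniform (X n) (orliczBall V R n) (P n) volume)
    {μ : ProbabilityMeasure ℝ} (hμ : μ ∈ momentBall V R) {c : ℝ}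
    (hc : ENNReal.ofReal c < rate V R α μ) :
    ∃ U ∈ 𝓝 μ, ∀ᶠ n : ℕ+ in atTop, P n {ω | empirical n (X n ω) ∈ U} ≤
      ENNReal.ofReal (Real.exp (-((n : ℕ) * c))) := by
  obtain ⟨c', hcc', hc'⟩ : ∃ c', c < c' ∧ ENNReal.ofReal c' < rate V R α μ := by
    obtain ⟨d, hd1, hd2⟩ := ENNReal.lt_iff_exists_nnreal_btwn.1 hc
    rw [← ENNReal.ofReal_coe_nnreal] at hd1 hd2
    exact ⟨d, (ENNReal.ofReal_lt_ofReal_iff'.1 hd1).1, hd2⟩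
  obtain ⟨f, hfc, hfo, hfi, hf0, hf⟩ := hV.exists_test_function hα hR hμ hc'
  -- One `δ` is spent on the variation of `∫ f` over `U`, the other on the volume of the ball in the
  -- denominator.
  set δ := (c' - c) / 2
  have hδ : 0 < δ := half_pos (sub_pos.2 hcc')
  set s := ∫ x, f x ∂(μ : Measure ℝ) - δ
  have hnhds : ∀ᶠ ν : ProbabilityMeasure ℝ in 𝓝[momentBall V R] μ,
      s < ∫ x, f x ∂(ν : Measure ℝ) :=
    (hV.continuousOn_integral hR hfc hfo μ hμ).eventually (lt_mem_nhds (sub_lt_self _ hδ))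
  obtain ⟨U, hUo, hμU, hU⟩ := mem_nhdsWithin.1 hnhds
  refine ⟨U, hUo.mem_nhds hμU, ?_⟩
  filter_upwards [hV.eventually_le_volume_orliczBall hα hR hαR hδ] with n hn
  have hn0 : (0 : ℝ) < (n : ℕ) := Nat.cast_pos.2 n.pos
  rw [hV.measure_empirical hR hX n hUo]
  have h1 : volume (orliczBall V R n ∩ {x | empirical n x ∈ U}) ≤
      ENNReal.ofReal (Real.exp (-((n : ℕ) * s)) * (∫ x, Real.exp (f x)) ^ (n : ℕ)) := by
    refine (measure_mono fun x hx => ?_).trans (volume_le_of_exp hfc hfi s n)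
    have h2 : s < ∫ y, f y ∂(empirical n x : Measure ℝ) :=
      hU ⟨hx.2, (hV.empirical_mem_momentBall_iff hR n x).2 hx.1⟩
    rw [integral_empirical, lt_inv_mul_iff₀ hn0] at h2
    rw [Set.mem_ofPred_eq]
    linarith
  refine (ENNReal.div_le_div h1 hn).trans ?_
  rw [← ENNReal.ofReal_div_of_pos (Real.exp_pos _)]
  refine ENNReal.ofReal_le_ofReal ?_
  conv_lhs => rw [← Real.exp_log hf0, ← Real.exp_nat_mul, ← Real.exp_add, ← Real.exp_sub]
  refine Real.exp_le_exp.2 ?_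
  have h3 : c ≤ s - Real.log (∫ x, Real.exp (f x)) +
      (Real.log (partition V α) - α * R - δ) := by
    simp only [s, δ]
    linarith
  have h4 := mul_le_mul_of_nonneg_left h3 hn0.le
  linarith

theorem IsOrlicz.local_lower_bound (hV : IsOrlicz V) (hR : 0 < R) {α : ℝ} (hα : α < 0)
    (hX : ∀ n, pdf.IsUniform (X n) (orliczBall V R n) (P n) volume)
    {μ : ProbabilityMeasure ℝ} {c : ℝ} (hc : rate V R α μ < ENNReal.ofReal c)
    {U : Set (ProbabilityMeasure ℝ)} (hU : IsOpen U) (hμU : μ ∈ U) :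
    ∀ᶠ n : ℕ+ in atTop, ENNReal.ofReal (Real.exp (-((n : ℕ) * c))) ≤
      P n {ω | empirical n (X n ω) ∈ U} := by
  have hμ : μ ∈ momentBall V R := by
    by_contra h
    rw [rate_of_notMem h] at hc
    exact not_top_lt hc
  rw [rate_of_mem hμ, ← hV.integral_eq_toReal_moment] at hc
  have hfin : klDiv (μ : Measure ℝ) (gibbs V α) ≠ ∞ := fun h => by
    rw [h, top_add] at hc
    exact not_top_lt hc
  rw [← ENNReal.ofReal_toReal hfin, ← ENNReal.ofReal_add ENNReal.toReal_nonneg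
    (mul_nonneg_of_nonpos_of_nonpos hα.le
      (sub_nonpos.2 (hV.integral_le_of_mem_momentBall hR hμ)))] at hc
  have hlt := (ENNReal.ofReal_lt_ofReal_iff'.1 hc).1
  -- The loss is taken equal to the whole slack between `c` and the rate, so after division by the
  -- volume bound the exponent is exactly `-n c`.
  filter_upwards [hV.eventually_le_volume hα hR hμ hfin hU hμU (sub_pos.2 hlt)] with n hn
  rw [hV.measure_empirical hR hX n hU]
  refine le_trans ?_ (ENNReal.div_le_div hn (hV.volume_orliczBall_le hα n))
  rw [← ENNReal.ofReal_div_of_pos (Real.exp_pos _), ← Real.exp_sub]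
  refine ENNReal.ofReal_le_ofReal (le_of_eq ?_)
  ring_nf

theorem IsOrlicz.satisfiesLDP (hV : IsOrlicz V) (hR : 0 < R) {α : ℝ} (hα : α < 0)
    (hαR : ∫⁻ x, ENNReal.ofReal (V x) ∂(gibbs V α) = ENNReal.ofReal R)
    [∀ n, IsProbabilityMeasure (P n)]
    (hX : ∀ n, pdf.IsUniform (X n) (orliczBall V R n) (P n) volume) :
    SatisfiesLDP P (fun n ω => empirical n (X n ω)) (rate V R α) :=
  satisfiesLDP_of_local_bounds (hV.isCompact_momentBall hR) (hV.measure_empirical_notMem hR hX)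
    (fun _ hx => rate_of_notMem hx)
    (fun _ hx _ _ hc => hV.local_upper_bound hR hα hαR hX hx hc)
    (fun _ _ hc _ hU hxU => hV.local_lower_bound hR hα hX hc hU hxU)

end Sampling

/-! ### Transfer to the topology of `d_W`. -/

section Wasserstein

variable {W : ℝ → ℝ} (dw : MetricSpace (ProbabilityMeasure ℝ))

theorem continuous_val_finiteMoment (hdw : InducesWeakTopology dw) :
    letI : MetricSpace (FiniteMoment W) := wassersteinMetric dw W
    Continuous fun μ : FiniteMoment W => μ.1 := by
  let : MetricSpace (FiniteMoment W) := wassersteinMetric dw W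
  have h : @Continuous _ _ _ dw.toPseudoMetricSpace.toUniformSpace.toTopologicalSpace
      fun μ : FiniteMoment W => μ.1 := by
    let := dw
    refine (LipschitzWith.of_dist_le_mul (K := 1) fun μ ν => ?_).continuous
    rw [NNReal.coe_one, one_mul]
    exact le_add_of_nonneg_right (abs_nonneg _)
  rwa [hdw] at h

theorem isLittleO_of_tendsto_div (hV : IsOrlicz V) (hW : IsOrlicz W)
    (h : Tendsto (fun x => V x / W x) (Bornology.cobounded ℝ) atTop) :
    W =o[Bornology.cobounded ℝ] V := by
  refine Asymptotics.isLittleO_iff.2 fun ε hε => ?_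
  filter_upwards [h.eventually_ge_atTop ε⁻¹] with x hx
  rw [Real.norm_of_nonneg (hV.nonneg x), Real.norm_of_nonneg (hW.nonneg x)]
  rcases (hW.nonneg x).eq_or_lt with h0 | h0
  · rw [← h0]
    exact mul_nonneg hε.le (hV.nonneg x)
  · rwa [le_div_iff₀ h0, inv_mul_le_iff₀ hε] at hx

theorem IsOrlicz.moment_lt_top_of_isLittleO (hV : IsOrlicz V) (hW : IsOrlicz W) {R : ℝ}
    (ho : W =o[Bornology.cobounded ℝ] V) {μ : ProbabilityMeasure ℝ} (hμ : μ ∈ momentBall V R) :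
    moment W μ < ∞ :=
  lt_top_iff_ne_top.2 ((lintegral_ofReal_ne_top_iff_integrable hW.continuous.aestronglyMeasurable
    (ae_of_all _ hW.nonneg)).2 (hV.integrable_of_isLittleO hW.continuous ho hμ))

/-- On a set of measures with bounded `V`-moment, the weak topology refines the topology of the
metric `d_W`. -/
theorem IsOrlicz.exists_isOpen_subset (hV : IsOrlicz V) (hW : IsOrlicz W) {R : ℝ} (hR : 0 < R)
    (ho : W =o[Bornology.cobounded ℝ] V) (hdw : InducesWeakTopology dw) (μ : FiniteMoment W)
    (hμ : μ.1 ∈ momentBall V R) (U : Set (FiniteMoment W)) :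
    letI : MetricSpace (FiniteMoment W) := wassersteinMetric dw W
    U ∈ 𝓝 μ → ∃ O : Set (ProbabilityMeasure ℝ), IsOpen O ∧ μ.1 ∈ O ∧
      ∀ ν : FiniteMoment W, ν.1 ∈ O → ν.1 ∈ momentBall V R → ν ∈ U := by
  let : MetricSpace (FiniteMoment W) := wassersteinMetric dw W
  intro hU
  obtain ⟨ε, hε, hεU⟩ := Metric.mem_nhds_iff.1 hU
  have hball : {ν | dw.dist ν μ.1 < ε / 2} ∈ 𝓝 μ.1 := by
    have h := @Metric.ball_mem_nhds _ dw.toPseudoMetricSpace μ.1 (ε / 2) (half_pos hε)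
    rwa [hdw] at h
  have hmom : ∀ᶠ ν in 𝓝[momentBall V R] μ.1,
      |(moment W ν).toReal - (moment W μ.1).toReal| < ε / 2 := by
    have h := hV.continuousOn_integral hR hW.continuous ho μ.1 hμ
    have h' := Metric.tendsto_nhds.1 h (ε / 2) (half_pos hε)
    simp_rw [hW.integral_eq_toReal_moment, Real.dist_eq] at h'
    exact h'
  obtain ⟨O, hO, hμO, hOs⟩ := mem_nhdsWithin.1 (inter_mem (mem_nhdsWithin_of_mem_nhds hball) hmom)
  refine ⟨O, hO, hμO, fun ν hνO hνK => hεU ?_⟩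
  obtain ⟨h1, h2⟩ := hOs ⟨hνO, hνK⟩
  have h1' : dw.dist ν.1 μ.1 < ε / 2 := h1
  have h2' : |(moment W ν.1).toReal - (moment W μ.1).toReal| < ε / 2 := h2
  change dw.dist ν.1 μ.1 + |(moment W ν.1).toReal - (moment W μ.1).toReal| < ε
  linarith

/-- The set is the image of the weakly compact moment ball under the identity, which is continuous
into `d_W` by `exists_isOpen_subset`. -/
theorem IsOrlicz.isCompact_momentBall_wasserstein (hV : IsOrlicz V) (hW : IsOrlicz W) {R : ℝ}
    (hR : 0 < R) (ho : W =o[Bornology.cobounded ℝ] V) (hdw : InducesWeakTopology dw) :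
    letI : MetricSpace (FiniteMoment W) := wassersteinMetric dw W
    IsCompact {μ : FiniteMoment W | μ.1 ∈ momentBall V R} := by
  let : MetricSpace (FiniteMoment W) := wassersteinMetric dw W
  have : CompactSpace (momentBall V R) :=
    isCompact_iff_compactSpace.1 (hV.isCompact_momentBall hR)
  set σ : momentBall V R → FiniteMoment W := fun μ =>
    ⟨μ.1, hV.moment_lt_top_of_isLittleO hW ho μ.2⟩
  have hσ : Continuous σ := by
    refine continuous_iff_continuousAt.2 fun μ U hU => ?_
    obtain ⟨O, hO, hμO, hOU⟩ := hV.exists_isOpen_subset dw hW hR ho hdw (σ μ) μ.2 U hU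
    have hmem : {ν : momentBall V R | ν.1 ∈ O} ∈ 𝓝 μ :=
      (hO.preimage continuous_subtype_val).mem_nhds hμO
    refine mem_map.2 (mem_of_superset hmem fun ν hν => ?_)
    exact hOU (σ ν) hν ν.2
  convert isCompact_range hσ
  ext μ
  exact ⟨fun h => ⟨⟨μ.1, h⟩, rfl⟩, fun ⟨ν, hν⟩ => hν ▸ ν.2⟩

theorem IsOrlicz.satisfiesLDP_wasserstein (hV : IsOrlicz V) (hW : IsOrlicz W) {R : ℝ}
    (hR : 0 < R) (ho : W =o[Bornology.cobounded ℝ] V) (hdw : InducesWeakTopology dw) {α : ℝ}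
    (hα : α < 0) (hαR : ∫⁻ x, ENNReal.ofReal (V x) ∂(gibbs V α) = ENNReal.ofReal R)
    {Ω : ℕ+ → Type*} [∀ n, MeasurableSpace (Ω n)] {P : ∀ n, Measure (Ω n)}
    {X : ∀ n : ℕ+, Ω n → (Fin n → ℝ)} [∀ n, IsProbabilityMeasure (P n)]
    (hX : ∀ n, pdf.IsUniform (X n) (orliczBall V R n) (P n) volume) :
    letI : MetricSpace (FiniteMoment W) := wassersteinMetric dw W
    SatisfiesLDP P (fun n ω => empiricalFM W n (X n ω)) (fun μ => rate V R α μ.1) := by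
  let : MetricSpace (FiniteMoment W) := wassersteinMetric dw W
  refine satisfiesLDP_of_local_bounds (hV.isCompact_momentBall_wasserstein dw hW hR ho hdw)
    (hV.measure_empirical_notMem hR hX) (fun _ hx => rate_of_notMem hx)
    (fun μ hμ c _ hc => ?_) (fun μ c hc U hU hμU => ?_)
  · obtain ⟨U, hU, h⟩ := hV.local_upper_bound hR hα hαR hX hμ hc
    exact ⟨_, (continuous_val_finiteMoment dw hdw).continuousAt.preimage_mem_nhds hU, h⟩
  · have hμ : μ.1 ∈ momentBall V R := by
      by_contra h
      rw [rate_of_notMem h] at hc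
      exact not_top_lt hc
    obtain ⟨O, hO, hμO, hOU⟩ := hV.exists_isOpen_subset dw hW hR ho hdw μ hμ U (hU.mem_nhds hμU)
    filter_upwards [hV.local_lower_bound hR hα hX hc hO hμO] with n hn
    refine hn.trans ?_
    -- A weakly open `O` lies in `U` only within the moment ball, but empirical measures leave that
    -- ball with probability zero.
    calc P n {ω | empirical n (X n ω) ∈ O}
        ≤ P n ({ω | empiricalFM W n (X n ω) ∈ U} ∪
            {ω | empirical n (X n ω) ∉ momentBall V R}) := by
          refine measure_mono fun ω hω => ?_
          by_cases h : empirical n (X n ω) ∈ momentBall V R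
          · exact Or.inl (hOU (empiricalFM W n (X n ω)) hω h)
          · exact Or.inr h
      _ ≤ _ := (measure_union_le _ _).trans (by rw [hV.measure_empirical_notMem hR hX, add_zero])

end Wasserstein

/-! ### Uniqueness of the parameter. -/

/-- If `J x > 0`, regularity gives a closed neighbourhood of `x` on which `J` exceeds some `c > 0`.
The upper bound for `J` forces exponential decay there, against the lower bound for `I` at its zero
`x`. -/
theorem satisfiesLDP_rate_unique {X : Type*} [TopologicalSpace X] [T2Space X] [RegularSpace X]
    {Ω : ℕ+ → Type*} [∀ n, MeasurableSpace (Ω n)] {P : ∀ n, Measure (Ω n)}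
    {ξ : ∀ n, Ω n → X} {I J : X → ℝ≥0∞} (hI : SatisfiesLDP P ξ I) (hJ : SatisfiesLDP P ξ J)
    {x : X} (hx : I x = 0) : J x = 0 := by
  by_contra hne
  obtain ⟨c, hc0, hc⟩ := ENNReal.lt_iff_exists_nnreal_btwn.1 (pos_iff_ne_zero.2 hne)
  obtain ⟨C, hC, hCc, hCs⟩ := exists_mem_nhds_isClosed_subset
    ((hJ.good c).isClosed.isOpen_compl.mem_nhds (not_le.2 hc : x ∈ {y | J y ≤ c}ᶜ))
  have hCm : MeasurableSet[borel X] C :=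
    MeasurableSet.of_compl (MeasurableSpace.measurableSet_generateFrom hCc.isOpen_compl)
  have h := ((hI.lower C hCm).trans (hI.middle C hCm)).trans (hJ.upper C hCm)
  rw [EReal.neg_le_neg_iff] at h
  have h1 : (((c : ℝ≥0∞)) : EReal) ≤ ⨅ y ∈ closure C, (J y : EReal) := by
    refine le_iInf₂ fun y hy => ?_
    rw [hCc.closure_eq] at hy
    have hy' : ¬ J y ≤ c := hCs hy
    exact EReal.coe_ennreal_le_coe_ennreal_iff.2 (not_le.1 hy').le
  have h2 : (⨅ y ∈ interior C, (I y : EReal)) ≤ 0 :=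
    (iInf₂_le x (mem_interior_iff_mem_nhds.2 hC)).trans (by simp [hx])
  have h3 := (h1.trans h).trans h2
  rw [← EReal.coe_ennreal_zero, EReal.coe_ennreal_le_coe_ennreal_iff] at h3
  exact absurd hc0 (not_lt.2 h3)

/-! ### Strict convexity of the rate function. -/

/-- Strict convexity of the relative entropy in its first argument. -/
theorem klDiv_mix_lt {X : Type*} [MeasurableSpace X] {μ ν G : Measure X} [IsProbabilityMeasure μ]
    [IsProbabilityMeasure ν] [IsProbabilityMeasure G] (hne : μ ≠ ν) (hμ : klDiv μ G ≠ ∞)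
    (hν : klDiv ν G ≠ ∞) {a b : ℝ≥0} (hab : a + b = 1) (ha : 0 < a) (hb : 0 < b) :
    klDiv (a • μ + b • ν) G < a * klDiv μ G + b * klDiv ν G := by
  have hμa := (klDiv_ne_top_iff.1 hμ).1
  have hνa := (klDiv_ne_top_iff.1 hν).1
  have hmix : a • μ + b • ν ≪ G := (hμa.smul_left a).add_left (hνa.smul_left b)
  set f : X → ℝ := fun x => (μ.rnDeriv G x).toReal
  set g : X → ℝ := fun x => (ν.rnDeriv G x).toReal
  have hf : Measurable f := (Measure.measurable_rnDeriv _ _).ennreal_toReal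
  have hg : Measurable g := (Measure.measurable_rnDeriv _ _).ennreal_toReal
  have hf0 : ∀ x, f x ∈ Set.Ici (0 : ℝ) := fun x => ENNReal.toReal_nonneg
  have hg0 : ∀ x, g x ∈ Set.Ici (0 : ℝ) := fun x => ENNReal.toReal_nonneg
  have hab' : (a : ℝ) + b = 1 := by exact_mod_cast hab
  have hrn : ∀ᵐ x ∂G, ((a • μ + b • ν).rnDeriv G x).toReal = a * f x + b * g x := by
    filter_upwards [Measure.rnDeriv_add (a • μ) (b • ν) G, Measure.rnDeriv_smul_left μ G a,
      Measure.rnDeriv_smul_left ν G b, Measure.rnDeriv_lt_top μ G, Measure.rnDeriv_lt_top ν G]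
      with x h1 h2 h3 h4 h5
    rw [h1, Pi.add_apply, h2, h3, Pi.smul_apply, Pi.smul_apply, ENNReal.smul_def,
      ENNReal.smul_def, smul_eq_mul, smul_eq_mul, ENNReal.toReal_add
      (ENNReal.mul_ne_top ENNReal.coe_ne_top h4.ne) (ENNReal.mul_ne_top ENNReal.coe_ne_top h5.ne)]
    simp [f, g]
  have hpt : ∀ x, ENNReal.ofReal (a * klFun (f x) + b * klFun (g x)) =
      a * ENNReal.ofReal (klFun (f x)) + b * ENNReal.ofReal (klFun (g x)) := fun x => by
    rw [ENNReal.ofReal_add (mul_nonneg a.coe_nonneg (klFun_nonneg (hf0 x)))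
      (mul_nonneg b.coe_nonneg (klFun_nonneg (hg0 x))), ENNReal.ofReal_mul a.coe_nonneg, ENNReal.ofReal_mul b.coe_nonneg,
      ENNReal.ofReal_coe_nnreal, ENNReal.ofReal_coe_nnreal]
  have hkf : Measurable fun x => ENNReal.ofReal (klFun (f x)) :=
    (measurable_klFun.comp hf).ennreal_ofReal
  have hkg : Measurable fun x => ENNReal.ofReal (klFun (g x)) :=
    (measurable_klFun.comp hg).ennreal_ofReal
  have hsum : ∫⁻ x, ENNReal.ofReal (a * klFun (f x) + b * klFun (g x)) ∂G =
      a * klDiv μ G + b * klDiv ν G := by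
    rw [klDiv_eq_lintegral_klFun_of_ac hμa, klDiv_eq_lintegral_klFun_of_ac hνa]
    simp_rw [hpt]
    rw [lintegral_add_left (hkf.const_mul _), lintegral_const_mul _ hkf, lintegral_const_mul _ hkg]
  have hfin : a * klDiv μ G + b * klDiv ν G ≠ ∞ := ENNReal.add_ne_top.2
    ⟨ENNReal.mul_ne_top ENNReal.coe_ne_top hμ, ENNReal.mul_ne_top ENNReal.coe_ne_top hν⟩
  have hle : ∀ x, klFun (a * f x + b * g x) ≤ a * klFun (f x) + b * klFun (g x) := fun x =>
    convexOn_klFun.2 (hf0 x) (hg0 x) a.coe_nonneg b.coe_nonneg hab'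
  have hrw : ∫⁻ x, ENNReal.ofReal (klFun ((a • μ + b • ν).rnDeriv G x).toReal) ∂G =
      ∫⁻ x, ENNReal.ofReal (klFun (a * f x + b * g x)) ∂G :=
    lintegral_congr_ae (hrn.mono fun x hx => by simp only [hx])
  rw [klDiv_eq_lintegral_klFun_of_ac hmix, hrw, ← hsum]
  refine lintegral_strict_mono_of_ae_le_of_frequently_ae_lt ?_ ?_
    (ae_of_all _ fun x => ENNReal.ofReal_le_ofReal (hle x)) ?_
  · exact (((measurable_klFun.comp hf).const_mul _).add
      ((measurable_klFun.comp hg).const_mul _)).ennreal_ofReal.aemeasurable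
  · rw [← hsum] at hfin
    exact ne_top_of_le_ne_top hfin (lintegral_mono fun x => ENNReal.ofReal_le_ofReal (hle x))
  -- Strict convexity of `klFun` makes the integrand inequality strict wherever the two densities
  -- differ; were that set null, the measures would coincide.
  · intro hcon
    refine hne ?_
    rw [← Measure.withDensity_rnDeriv_eq _ _ hμa, ← Measure.withDensity_rnDeriv_eq _ _ hνa]
    refine withDensity_congr_ae ?_
    filter_upwards [hcon, Measure.rnDeriv_lt_top μ G, Measure.rnDeriv_lt_top ν G] with x hx h4 h5
    by_contra hxne
    have hfg : f x ≠ g x := fun h => hxne ((ENNReal.toReal_eq_toReal_iff' h4.ne h5.ne).1 h)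
    have hlt := strictConvexOn_klFun.2 (hf0 x) (hg0 x) hfg (NNReal.coe_pos.2 ha)
      (NNReal.coe_pos.2 hb) hab'
    simp only [smul_eq_mul] at hlt
    refine hx ?_
    refine (ENNReal.ofReal_lt_ofReal_iff_of_nonneg (klFun_nonneg ?_)).2 hlt |>.ne
    exact add_nonneg (mul_nonneg a.coe_nonneg (hf0 x)) (mul_nonneg b.coe_nonneg (hg0 x))

theorem moment_mix (V : ℝ → ℝ) {a b : ℝ≥0} (hab : a + b = 1) (μ ν : ProbabilityMeasure ℝ) :
    moment V (mix a b hab μ ν) = a * moment V μ + b * moment V ν := by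
  have : (mix a b hab μ ν : Measure ℝ) = a • (μ : Measure ℝ) + b • (ν : Measure ℝ) := rfl
  rw [moment, this, lintegral_add_measure, lintegral_smul_measure, lintegral_smul_measure]
  simp [moment, ENNReal.smul_def]

/-- On the moment ball, which is convex, the moment term is affine and nonnegative, so strictness
comes entirely from the entropy. -/
theorem IsOrlicz.strictlyConvex_rate (hV : IsOrlicz V) {R α : ℝ} (hR : 0 < R) (hα : α < 0) :
    StrictlyConvex (rate V R α) := by
  have := hV.isProbabilityMeasure_gibbs hα
  intro μ ν hne hμ hν a b hab ha hb
  have hmem : ∀ {ρ}, rate V R α ρ < ∞ → ρ ∈ momentBall V R := fun {ρ} h => by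
    by_contra hcon
    rw [rate_of_notMem hcon] at h
    exact lt_irrefl _ h
  have hμK := hmem hμ
  have hνK := hmem hν
  rw [rate_of_mem hμK] at hμ
  rw [rate_of_mem hνK] at hν
  have hab' : (a : ℝ) + b = 1 := by exact_mod_cast hab
  have hμm : moment V μ ≠ ∞ := ne_top_of_le_ne_top ENNReal.ofReal_ne_top hμK
  have hνm : moment V ν ≠ ∞ := ne_top_of_le_ne_top ENNReal.ofReal_ne_top hνK
  have hmixK : mix a b hab μ ν ∈ momentBall V R := by
    rw [momentBall, Set.mem_ofPred_eq, moment_mix]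
    calc (a : ℝ≥0∞) * moment V μ + b * moment V ν
        ≤ a * ENNReal.ofReal R + b * ENNReal.ofReal R := by gcongr <;> assumption
      _ = ENNReal.ofReal R := by
        rw [← add_mul, ← ENNReal.coe_add, hab, ENNReal.coe_one, one_mul]
  have hnonneg : ∀ {ρ}, ρ ∈ momentBall V R → 0 ≤ α * ((moment V ρ).toReal - R) := fun {ρ} h =>
    mul_nonneg_of_nonpos_of_nonpos hα.le
      (sub_nonpos.2 (ENNReal.toReal_le_of_le_ofReal hR.le h))
  have hlin : ENNReal.ofReal (α * ((moment V (mix a b hab μ ν)).toReal - R)) =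
      a * ENNReal.ofReal (α * ((moment V μ).toReal - R)) +
        b * ENNReal.ofReal (α * ((moment V ν).toReal - R)) := by
    rw [← ENNReal.ofReal_coe_nnreal, ← ENNReal.ofReal_coe_nnreal, ← ENNReal.ofReal_mul a.coe_nonneg,
      ← ENNReal.ofReal_mul b.coe_nonneg, ← ENNReal.ofReal_add (mul_nonneg a.coe_nonneg (hnonneg hμK))
      (mul_nonneg b.coe_nonneg (hnonneg hνK)), moment_mix, ENNReal.toReal_add
      (ENNReal.mul_ne_top ENNReal.coe_ne_top hμm) (ENNReal.mul_ne_top ENNReal.coe_ne_top hνm),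
      ENNReal.toReal_mul, ENNReal.toReal_mul, ENNReal.coe_toReal, ENNReal.coe_toReal]
    congr 1
    have : R = a * R + b * R := by rw [← add_mul, hab', one_mul]
    linear_combination (-α) * this
  have hne' : (μ : Measure ℝ) ≠ ν := fun h => hne (Subtype.ext h)
  have hkl := klDiv_mix_lt hne' (ENNReal.add_lt_top.1 hμ).1.ne (ENNReal.add_lt_top.1 hν).1.ne
    hab ha hb
  rw [rate_of_mem hmixK, rate_of_mem hμK, rate_of_mem hνK, hlin, mul_add, mul_add,
    add_add_add_comm]
  refine ENNReal.add_lt_add_right ?_ hkl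
  exact ENNReal.add_ne_top.2 ⟨ENNReal.mul_ne_top ENNReal.coe_ne_top ENNReal.ofReal_ne_top,
    ENNReal.mul_ne_top ENNReal.coe_ne_top ENNReal.ofReal_ne_top⟩

/-- As the moment is exactly `R`, the linear term vanishes for every `β`. For `β = α` the rate is
`0`; for another admissible `β` it can vanish only if the two Gibbs measures agree. -/
theorem IsOrlicz.rate_gibbs (hV : IsOrlicz V) {R α : ℝ} (hR : 0 < R) (hα : α < 0)
    (hαR : ∫⁻ x, ENNReal.ofReal (V x) ∂(gibbs V α) = ENNReal.ofReal R) (β : ℝ) :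
    rate V R β (gibbsPM hV hα) = klDiv (gibbs V α) (gibbs V β) := by
  have hmom : moment V (gibbsPM hV hα) = ENNReal.ofReal R := hαR
  rw [rate_of_mem (μ := gibbsPM hV hα) hmom.le, hmom, ENNReal.toReal_ofReal hR.le, sub_self,
    mul_zero, ENNReal.ofReal_zero, add_zero]
  rfl

end OrliczLDP

/-! ### The main theorem. -/

theorem theoremA (V : ℝ → ℝ) (hV : IsOrlicz V) (R : ℝ) (hR : 0 < R)
    {Ω : ℕ+ → Type*} [∀ n, MeasurableSpace (Ω n)] (P : ∀ n, Measure (Ω n))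
    (hP : ∀ n, IsProbabilityMeasure (P n))
    (X : ∀ n : ℕ+, Ω n → (Fin n → ℝ))
    (hX : ∀ n, pdf.IsUniform (X n) (orliczBall V R n) (P n) volume) :
    ∃ α : ℝ, α < 0 ∧
      SatisfiesLDP P (fun n ω => empirical n (X n ω)) (rate V R α) ∧
      (∀ β : ℝ, β < 0 →
        SatisfiesLDP P (fun n ω => empirical n (X n ω)) (rate V R β) → β = α) ∧
      StrictlyConvex (rate V R α) ∧
      ∀ W : ℝ → ℝ, IsOrlicz W →
        Tendsto (fun x => V x / W x) (Bornology.cobounded ℝ) atTop →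
        ∀ dw : MetricSpace (ProbabilityMeasure ℝ),
          InducesWeakTopology dw →
          letI : MetricSpace (FiniteMoment W) := wassersteinMetric dw W
          SatisfiesLDP P (fun n ω => empiricalFM W n (X n ω)) (fun μ => rate V R α μ.1) := by
  obtain ⟨α, hα, hαR⟩ := hV.exists_lintegral_gibbs_eq hR
  have hLDP := hV.satisfiesLDP hR hα hαR hX
  have := hV.isProbabilityMeasure_gibbs hα
  refine ⟨α, hα, hLDP, fun β hβ hLDPβ => ?_, hV.strictlyConvex_rate hR hα,
    fun W hW hVW dw hdw => hV.satisfiesLDP_wasserstein dw hW hR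
      (isLittleO_of_tendsto_div hV hW hVW) hdw hα hαR hX⟩
  have := hV.isProbabilityMeasure_gibbs hβ
  have h0 : rate V R α (gibbsPM hV hα) = 0 := by
    rw [hV.rate_gibbs hR hα hαR, InformationTheory.klDiv_self]
  have h1 := satisfiesLDP_rate_unique hLDP hLDPβ h0
  rw [hV.rate_gibbs hR hα hαR, InformationTheory.klDiv_eq_zero_iff] at h1
  exact (hV.gibbs_injective hα hβ h1).symm
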